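/- All vector spaces are real. A \emph{polytope} in a finite-dimensional vector space $E$ is the convex hull $M$ of a non-empty finite subset of $E$; its dimension is that of its affine hull $\operatorname{aff}(M)$. A \emph{face} of $M$ is a convex subset $F\subseteq M$ such that $x,y\in F$ whenever $x,y\in M$ and $tx+(1-t)y\in F$ for some $t\in{]0,1[}$; vertices are the points $x$ such that $\{x\}$ is a face, and edges are the non-empty faces of dimension $1$. An $n$-dimensional polytope is \emph{simple} if each of its vertices is contained in exactly $n$ edges. Let $Y$ be a Hausdorff locally convex topological vector space and $m\in\mathbb{N}_0\cup\{\infty\}$. For a polytope $P\subseteq E$, let $V_P$ be the vector space parallel to $\operatorname{aff}(P)$. A function $f\colon P\to Y$ is called $C^m$ if it is continuous and, for each $k\in\mathbb{N}$ with $k\le m$, the iterated directional derivatives $(D_{y_k}\cdots D_{y_1}f)(x)$ exist for all $x$ in the interior of $P$ relative to $\operatorname{aff}(P)$ and all $y_1,\dots,y_k\in V_P$, and extend to a continuous map $d^kf\colon P\times V_P^k\to Y$; put $d^0f:=f$. The vector space $C^m(P,Y)$ of all such functions is given the initial topology with respect to the maps $f\mapsto d^kf$, $0\le k\le m$ ($k$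 finite), into the spaces $C(P\times V_P^k,Y)$ with the compact-open topology. \textbf{Theorem.} Let $M$ be a simple polytope of dimension $n$ in a finite-dimensional vector space, let $\ell\in\{1,\dots,n-1\}$, and let $\mathcal{F}$ be the set of all $\ell$-dimensional faces of $M$. Let $Y$ be a Hausdorff locally convex topological vector space and $m\in\mathbb{N}_0\cup\{\infty\}$. Let $\mathcal{E}$ be the vector subspace of $\prod_{F\in\mathcal{F}}C^m(F,Y)$ consisting of all families $(f_F)_{F\in\mathcal{F}}$ such that $f_F|_{F\cap G}=f_G|_{F\cap G}$ for all $F,G\in\mathcal{F}$, with the topology induced by the product topology. Then $\mathcal{E}$ is closed in $\prod_{F\in\mathcal{F}}C^m(F,Y)$; for each $f\in C^m(M,Y)$ and $F\in\mathcal{F}$ the restriction $f|_F$ is in $C^m(F,Y)$; and the map \[ r\colon C^m(M,Y)\to\mathcal{E},\quad f\mapsto (f|_F)_{F\in\mathcal{F}} \] is surjective, continuous and linear, and admits a continuous linear right inverse $\sigma\colon\mathcal{E}\to C^m(M,Y)$. -/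

import Mathlib

open Set Filter Topology

noncomputable section

namespace PolytopeExt

section Polytopes

variable {E : Type*} [AddCommGroup E] [Module ℝ E]

/-- A (convex) polytope: the convex hull of a non-empty finite set. -/
def IsPolytope (M : Set E) : Prop :=
  ∃ S : Set E, S.Finite ∧ S.Nonempty ∧ M = convexHull ℝ S

/-- The vector space parallel to the affine subspace generated by `M`. -/
abbrev dir (M : Set E) : Submodule ℝ E := vectorSpan ℝ M

/-- The dimension of a (non-empty) convex set: the dimension of its affine hull. -/
def dim (M : Set E) : ℕ := Module.finrank ℝ (dir M)

/-- A face of `M`: a convex subset `F ⊆ M` such that `x, y ∈ F` whenever `x, y ∈ M` and some point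
`t x + (1 - t) y` with `0 < t < 1` belongs to `F`. -/
def IsFace (M F : Set E) : Prop := Convex ℝ F ∧ IsExtreme ℝ M F

/-- The set of all non-empty faces of `M` of dimension `d`. -/
def faces (M : Set E) (d : ℕ) : Set (Set E) := {F | IsFace M F ∧ F.Nonempty ∧ dim F = d}

/-- `M` is a simple polytope of dimension `n`: an `n`-dimensional polytope each of whose vertices
is contained in exactly `n` edges. -/
def IsSimplePolytope (n : ℕ) (M : Set E) : Prop :=
  IsPolytope M ∧ dim M = n ∧
    ∀ x : E, IsFace M {x} → {F : Set E | F ∈ faces M 1 ∧ x ∈ F}.encard = n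

end Polytopes

section CmFunctions

variable {E : Type*} [AddCommGroup E] [Module ℝ E] [TopologicalSpace E]
variable {Y : Type*} [AddCommGroup Y] [Module ℝ Y] [TopologicalSpace Y]

/-- Extension by zero. It is only used to write down difference quotients; at points of the
relative interior of `M`, and in directions parallel to `M`, the limit for `t → 0` depends only on
the values on (the relative interior of) `M`. -/
def extendZero {M : Set E} (g : M → Y) : E → Y := Function.extend Subtype.val g 0

/-- `L` is the directional derivative `D_y g (x) = lim_{t → 0} (g (x + t y) - g x) / t`. -/
def HasDirDerivAt {M : Set E} (g : M → Y) (x y : E) (L : Y) : Prop :=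
  Tendsto (fun t : ℝ => t⁻¹ • (extendZero g (x + t • y) - extendZero g x)) (𝓝[≠] 0) (𝓝 L)

/-- The iterated directional derivatives `(D_{y_k} ⋯ D_{y_1} f) (x)` exist for all `x` in the
interior of `M` relative to its affine hull and all directions `y_1, …, y_k` parallel to that
affine hull, and `d (x, y_1, …, y_k)` is their value. -/
def IsIterDirDeriv {M : Set E} (f : M → Y) : (k : ℕ) → (M × (Fin k → dir M) → Y) → Prop
  | 0, d => ∀ x : M, (x : E) ∈ intrinsicInterior ℝ M → ∀ y, d (x, y) = f x
  | k + 1, d => ∃ d' : M × (Fin k → dir M) → Y, IsIterDirDeriv f k d' ∧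
      ∀ x : M, (x : E) ∈ intrinsicInterior ℝ M → ∀ y : Fin (k + 1) → dir M,
        HasDirDerivAt (fun z : M => d' (z, Fin.init y)) (x : E) (y (Fin.last k) : E) (d (x, y))

/-- `f : M → Y` is `C^m`: it is continuous and, for all `k ≤ m`, its `k`-th iterated directional
derivatives exist on the relative interior of `M` and extend to a continuous map
`d^k f : M × V^k → Y`, where `V` is the vector space parallel to the affine hull of `M`. -/
def IsCm (m : ℕ∞) {M : Set E} (f : M → Y) : Prop :=
  Continuous f ∧ ∀ k : ℕ, (k : ℕ∞) ≤ m →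
    ∃ d : C(M × (Fin k → dir M), Y), IsIterDirDeriv f k d

theorem extendZero_add {M : Set E} (f g : M → Y) :
    extendZero (f + g) = extendZero f + extendZero g := by
  funext x
  by_cases hx : x ∈ M
  · have h (u : M → Y) : extendZero u x = u ⟨x, hx⟩ :=
      Subtype.val_injective.extend_apply u (0 : E → Y) ⟨x, hx⟩
    simp [h]
  · have h (u : M → Y) : extendZero u x = 0 :=
      Function.extend_apply' u (0 : E → Y) x fun h => h.elim fun a ha => hx (ha ▸ a.2)
    simp [h]

theorem extendZero_smul {M : Set E} (c : ℝ) (f : M → Y) :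
    extendZero (c • f) = c • extendZero f := by
  funext x
  by_cases hx : x ∈ M
  · have h (u : M → Y) : extendZero u x = u ⟨x, hx⟩ :=
      Subtype.val_injective.extend_apply u (0 : E → Y) ⟨x, hx⟩
    simp [h]
  · have h (u : M → Y) : extendZero u x = 0 :=
      Function.extend_apply' u (0 : E → Y) x fun h => h.elim fun a ha => hx (ha ▸ a.2)
    simp [h]

theorem IsIterDirDeriv.add [IsTopologicalAddGroup Y] {M : Set E} {f g : M → Y} :
    ∀ {k : ℕ} {d e : M × (Fin k → dir M) → Y},
      IsIterDirDeriv f k d → IsIterDirDeriv g k e → IsIterDirDeriv (f + g) k (d + e)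
  | 0, _, _, hd, he => fun x hx y => by simp [hd x hx y, he x hx y]
  | k + 1, d, e, ⟨d', hd', hd⟩, ⟨e', he', he⟩ => by
    refine ⟨d' + e', hd'.add he', fun x hx y => ?_⟩
    have h := (hd x hx y).add (he x hx y)
    have hs : (fun z : M => (d' + e') (z, Fin.init y)) =
        (fun z : M => d' (z, Fin.init y)) + fun z : M => e' (z, Fin.init y) := rfl
    unfold HasDirDerivAt
    rw [hs, extendZero_add]
    refine h.congr fun t => ?_
    simp only [Pi.add_apply, ← smul_add]
    congr 1
    abel

theorem IsIterDirDeriv.smul [ContinuousSMul ℝ Y] {M : Set E} {f : M → Y} (c : ℝ) :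
    ∀ {k : ℕ} {d : M × (Fin k → dir M) → Y},
      IsIterDirDeriv f k d → IsIterDirDeriv (c • f) k (c • d)
  | 0, _, hd => fun x hx y => by simp [hd x hx y]
  | k + 1, d, ⟨d', hd', hd⟩ => by
    refine ⟨c • d', hd'.smul c, fun x hx y => ?_⟩
    have h := (hd x hx y).const_smul c
    have hs : (fun z : M => (c • d') (z, Fin.init y)) =
        c • fun z : M => d' (z, Fin.init y) := rfl
    unfold HasDirDerivAt
    rw [hs, extendZero_smul]
    refine h.congr fun t => ?_
    simp only [Pi.smul_apply, ← smul_sub, smul_comm c]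

variable [IsTopologicalAddGroup Y] [ContinuousSMul ℝ Y]

/-- The `C^m`-functions `M → Y`, as a vector space with pointwise operations. -/
def cmSubmodule (m : ℕ∞) (M : Set E) (Y : Type*) [AddCommGroup Y] [Module ℝ Y]
    [TopologicalSpace Y] [IsTopologicalAddGroup Y] [ContinuousSMul ℝ Y] :
    Submodule ℝ (M → Y) where
  carrier := {f | IsCm m f}
  add_mem' := fun hf hg => ⟨hf.1.add hg.1, fun k hk => by
    obtain ⟨d, hd⟩ := hf.2 k hk
    obtain ⟨e, he⟩ := hg.2 k hk
    exact ⟨d + e, hd.add he⟩⟩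
  zero_mem' := by
    have key : ∀ k : ℕ, IsIterDirDeriv (0 : M → Y) k 0 := by
      intro k
      induction k with
      | zero => exact fun _ _ _ => rfl
      | succ k ih =>
        refine ⟨0, ih, fun x _ y => ?_⟩
        have h0 : extendZero (fun _ : M => (0 : Y)) = 0 := by
          have := extendZero_smul (0 : ℝ) (fun _ : M => (0 : Y))
          rw [zero_smul, zero_smul] at this
          exact this
        unfold HasDirDerivAt
        simp only [Pi.zero_apply, h0, sub_self, smul_zero]
        exact tendsto_const_nhds
    exact ⟨continuous_zero, fun k _ => ⟨0, key k⟩⟩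
  smul_mem' := fun c _ hf => ⟨hf.1.const_smul c, fun k hk => by
    obtain ⟨d, hd⟩ := hf.2 k hk
    exact ⟨c • d, hd.smul c⟩⟩

/-- The space `C^m(M, Y)`. This is a type of its own, as it does not carry the topology of
pointwise convergence. -/
def Cm (m : ℕ∞) (M : Set E) (Y : Type*) [AddCommGroup Y] [Module ℝ Y]
    [TopologicalSpace Y] [IsTopologicalAddGroup Y] [ContinuousSMul ℝ Y] : Type _ :=
  cmSubmodule m M Y

instance (m : ℕ∞) (M : Set E) : AddCommGroup (Cm m M Y) :=
  inferInstanceAs (AddCommGroup (cmSubmodule m M Y))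

instance (m : ℕ∞) (M : Set E) : Module ℝ (Cm m M Y) :=
  inferInstanceAs (Module ℝ (cmSubmodule m M Y))

instance (m : ℕ∞) (M : Set E) : CoeFun (Cm m M Y) (fun _ => M → Y) :=
  ⟨fun f => f.1⟩

/-- The continuous map `d^k f : M × V^k → Y` extending the `k`-th iterated directional derivatives
of the `C^m`-function `f`, for `k ≤ m`. It is unique if the relative interior of `M` is dense
in `M`. -/
def Cm.d {m : ℕ∞} {M : Set E} (k : ℕ) (hk : (k : ℕ∞) ≤ m) (f : Cm m M Y) :
    C(M × (Fin k → dir M), Y) :=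
  (f.2.2 k hk).choose

/-- The compact-open `C^m`-topology: the initial topology with respect to the maps `f ↦ d^k f`,
`k ≤ m`, into spaces of continuous functions with the compact-open topology. -/
instance (m : ℕ∞) (M : Set E) : TopologicalSpace (Cm m M Y) :=
  ⨅ (k : ℕ) (hk : (k : ℕ∞) ≤ m),
    TopologicalSpace.induced (Cm.d k hk) ContinuousMap.compactOpen

/-- The vector space of families `(f_F)_F` of `C^m`-functions on the `ℓ`-dimensional faces of `M`
with `f_F = f_G` on `F ∩ G` for all `F`, `G`; its topology is induced by the product topology. -/
def compatible (m : ℕ∞) (M : Set E) (ℓ : ℕ) (Y : Type*) [AddCommGroup Y] [Module ℝ Y]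
    [TopologicalSpace Y] [IsTopologicalAddGroup Y] [ContinuousSMul ℝ Y] :
    Submodule ℝ ((F : faces M ℓ) → Cm m (F : Set E) Y) where
  carrier := {f | ∀ (F G : faces M ℓ) (x : E) (hF : x ∈ (F : Set E)) (hG : x ∈ (G : Set E)),
    f F ⟨x, hF⟩ = f G ⟨x, hG⟩}
  add_mem' := fun hf hg F G x hF hG =>
    congrArg₂ (· + ·) (hf F G x hF hG) (hg F G x hF hG)
  zero_mem' := fun _ _ _ _ _ => rfl
  smul_mem' := fun c _ hf F G x hF hG => congrArg (c • ·) (hf F G x hF hG)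

end CmFunctions

end PolytopeExt

end

/-! Near each vertex a simple polytope looks like an orthant. The `n` edge vectors at a vertex `v`
form a basis of `dir M`, and `M` lies in the orthant with apex `v` that they span
(`exists_linearIndependent_edges`). The set `star M v` is relatively open in that orthant
(`VertexChart.eventually_mem_star`), and the stars cover `M`: a point lies in the star of each
vertex that has positive weight in some representation of it as a convex combination of vertices.
Hence finitely many vertex charts suffice, glued by a smooth partition of unity `h` with further
cut-offs `χ`.

On an orthant, a function on the union of the `ℓ`-dimensional coordinate faces is extended by
pull-back along coordinate projections: start with the value at the apex, then, for dimensions `1,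
…, ℓ`, add the pull-backs of the remaining errors on the coordinate faces. Each error vanishes on
lower-dimensional coordinate faces, so the corrections do not disturb each other
(`skeletonExt_eq_of_proj_eq`). This is applied to `h v • g`. The factor `h v` kills the places where
a projection leaves `M`, and `χ v` kills the pull-back on the faces that do not contain `v`
(`extension_eq`).

Smoothness of the extension and continuity of the operator are proved together: `CkFam` lets `g` be
a parameter, and joint continuity in parameter, point and directions amounts to continuity into `Cm`
(`ckFam_of_continuous_cm`, `exists_continuous_cm`). The analytic core is `CkFam.pullback`. A
projection may send relative interior points of `M` to boundary points of a face, where the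
derivatives are known only as continuous extensions; by the mean value theorem these are still
genuine derivatives along segments inside the face (`dirDeriv_of_intrinsicInterior`). -/

noncomputable section

namespace PolytopeExt

/-! ### Relative interiors of convex sets -/

section RelativeInterior

variable {E : Type*} [AddCommGroup E] [Module ℝ E] [TopologicalSpace E]

theorem mem_intrinsicInterior_iff_eventually {M : Set E} {x : E} :
    x ∈ intrinsicInterior ℝ M ↔ x ∈ M ∧ ∀ᶠ y in 𝓝 x, y ∈ affineSpan ℝ M → y ∈ M := by
  rw [mem_intrinsicInterior]
  constructor
  · rintro ⟨y, hy, rfl⟩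
    have hyM : (y : E) ∈ M := by simpa using interior_subset hy
    refine ⟨hyM, ?_⟩
    rw [mem_interior_iff_mem_nhds, nhds_subtype, mem_comap] at hy
    obtain ⟨t, ht, hts⟩ := hy
    filter_upwards [ht] with z hz hz'
    exact hts (show (⟨z, hz'⟩ : affineSpan ℝ M) ∈ _ from hz)
  · rintro ⟨hx, h⟩
    refine ⟨⟨x, subset_affineSpan ℝ M hx⟩, ?_, rfl⟩
    rw [mem_interior_iff_mem_nhds, nhds_subtype, mem_comap]
    exact ⟨_, h, fun z hz => hz z.2⟩

theorem add_mem_affineSpan_of_mem_dir {M : Set E} {x y : E} (hx : x ∈ affineSpan ℝ M)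
    (hy : y ∈ dir M) : x + y ∈ affineSpan ℝ M := by
  rw [dir, ← direction_affineSpan] at hy
  have := AffineSubspace.vadd_mem_of_mem_direction hy hx
  rwa [vadd_eq_add, add_comm] at this

theorem sub_mem_dir_of_mem_affineSpan {M : Set E} {x y : E} (hx : x ∈ affineSpan ℝ M)
    (hy : y ∈ affineSpan ℝ M) : x - y ∈ dir M := by
  rw [dir, ← direction_affineSpan]
  exact AffineSubspace.vsub_mem_direction hx hy

theorem eventually_mem_intrinsicInterior {M : Set E} {x : E} (hx : x ∈ intrinsicInterior ℝ M) :
    ∀ᶠ y in 𝓝 x, y ∈ affineSpan ℝ M → y ∈ intrinsicInterior ℝ M := by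
  rw [mem_intrinsicInterior_iff_eventually] at hx
  filter_upwards [eventually_eventually_nhds.2 hx.2] with y hy hy'
  exact mem_intrinsicInterior_iff_eventually.2 ⟨hy.self_of_nhds hy', hy⟩

variable [IsTopologicalAddGroup E] [ContinuousSMul ℝ E]

theorem tendsto_add_smul_nhds_zero (x y : E) : Tendsto (fun t : ℝ => x + t • y) (𝓝 0) (𝓝 x) := by
  have : Continuous fun t : ℝ => x + t • y := by fun_prop
  simpa using this.tendsto 0

theorem eventually_add_smul_mem_intrinsicInterior {M : Set E} {x y : E}
    (hx : x ∈ intrinsicInterior ℝ M) (hy : y ∈ dir M) :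
    ∀ᶠ t : ℝ in 𝓝 0, x + t • y ∈ intrinsicInterior ℝ M := by
  filter_upwards [(tendsto_add_smul_nhds_zero x y).eventually
    (eventually_mem_intrinsicInterior hx)] with t ht
  exact ht (add_mem_affineSpan_of_mem_dir
    (subset_affineSpan ℝ M (intrinsicInterior_subset hx)) ((dir M).smul_mem t hy))

/-- The homothety with centre `x` and ratio `s⁻¹` carries points near the combination to points near
`z`; convexity brings them back. -/
theorem combo_mem_intrinsicInterior {M : Set E} (hM : Convex ℝ M) {x z : E}
    (hz : z ∈ intrinsicInterior ℝ M) (hx : x ∈ M) {s : ℝ} (hs : 0 < s) (hs1 : s ≤ 1) :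
    x + s • (z - x) ∈ intrinsicInterior ℝ M := by
  have hzM := intrinsicInterior_subset hz
  have hq : x + s • (z - x) ∈ M := by
    have := hM hx hzM (sub_nonneg.2 hs1) hs.le (by ring)
    convert this using 1
    module
  refine mem_intrinsicInterior_iff_eventually.2 ⟨hq, ?_⟩
  have hc : Continuous fun y : E => z + s⁻¹ • (y - (x + s • (z - x))) := by fun_prop
  have ht := hc.tendsto (x + s • (z - x))
  simp only [sub_self, smul_zero, add_zero] at ht
  filter_upwards [ht.eventually (mem_intrinsicInterior_iff_eventually.1 hz).2] with y hy hyM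
  have hz' := hy (add_mem_affineSpan_of_mem_dir (subset_affineSpan ℝ M hzM)
    ((dir M).smul_mem _ (sub_mem_dir_of_mem_affineSpan hyM (subset_affineSpan ℝ M hq))))
  have := hM hx hz' (sub_nonneg.2 hs1) hs.le (by ring)
  convert this using 1
  rw [smul_add, smul_smul, mul_inv_cancel₀ hs.ne']
  module

theorem intrinsicInterior_nonempty_of_convex [T2Space E] [FiniteDimensional ℝ E] {M : Set E}
    (hM : Convex ℝ M) (hne : M.Nonempty) : (intrinsicInterior ℝ M).Nonempty := by
  let e : E ≃L[ℝ] (Fin (Module.finrank ℝ E) → ℝ) :=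
    ContinuousLinearEquiv.ofFinrankEq (by simp)
  have h1 : (intrinsicInterior ℝ (e '' M)).Nonempty :=
    (hne.image e).intrinsicInterior (hM.linear_image e.toLinearMap)
  have h2 := ContinuousAffineEquiv.intrinsicInterior_image e.toContinuousAffineEquiv M
  have h3 : (e.toContinuousAffineEquiv : E → _) = e := rfl
  rw [h3] at h2
  rw [h2] at h1
  exact h1.of_image

/-- Two functions which are continuous on a convex set and agree on the part of its relative
interior which lies in an open set agree on all of the part which lies in that open set. -/
theorem eqOn_of_eqOn_intrinsicInterior [T2Space E] [FiniteDimensional ℝ E] {Z : Type*}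
    [TopologicalSpace Z] [T2Space Z] {M O : Set E} (hM : Convex ℝ M) (hO : IsOpen O) {f g : E → Z}
    (hf : ContinuousOn f M) (hg : ContinuousOn g M)
    (h : ∀ x ∈ intrinsicInterior ℝ M, x ∈ O → f x = g x) : ∀ x ∈ M, x ∈ O → f x = g x := by
  intro x hx hxO
  obtain ⟨z, hz⟩ := intrinsicInterior_nonempty_of_convex hM ⟨x, hx⟩
  -- Relative interior points approach `x` along the segment towards `z`.
  have ht : Tendsto (fun s : ℝ => x + s • (z - x)) (𝓝[>] 0) (𝓝 x) :=
    (tendsto_add_smul_nhds_zero x (z - x)).mono_left nhdsWithin_le_nhds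
  have hri : ∀ᶠ s : ℝ in 𝓝[>] 0, x + s • (z - x) ∈ intrinsicInterior ℝ M := by
    filter_upwards [Ioc_mem_nhdsGT one_pos] with s hs
    exact combo_mem_intrinsicInterior hM hz hx hs.1 hs.2
  have ht' : Tendsto (fun s : ℝ => x + s • (z - x)) (𝓝[>] 0) (𝓝[M] x) :=
    tendsto_nhdsWithin_iff.2 ⟨ht, hri.mono fun s hs => intrinsicInterior_subset hs⟩
  refine tendsto_nhds_unique ((hf x hx).tendsto.comp ht')
    (((hg x hx).tendsto.comp ht').congr' ?_)
  filter_upwards [hri, ht.eventually (hO.mem_nhds hxO)] with s hs hs'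
  exact (h _ hs hs').symm

end RelativeInterior

/-! ### Directional derivatives and the mean value theorem -/

section MeanValue

variable {E : Type*} [AddCommGroup E] [Module ℝ E]
variable {Y : Type*} [AddCommGroup Y] [Module ℝ Y] [TopologicalSpace Y]

/-- `L` is the derivative of `f : E → Y` at `x` in the direction `y`. -/
def DirDeriv (f : E → Y) (x y : E) (L : Y) : Prop :=
  Tendsto (fun t : ℝ => t⁻¹ • (f (x + t • y) - f x)) (𝓝[≠] 0) (𝓝 L)

theorem DirDeriv.congr {f g : E → Y} {x y : E} {L : Y} (h : DirDeriv f x y L)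
    (hfg : ∀ᶠ t : ℝ in 𝓝 0, f (x + t • y) = g (x + t • y)) : DirDeriv g x y L := by
  have h0 : f x = g x := by simpa using hfg.self_of_nhds
  refine Tendsto.congr' ?_ h
  filter_upwards [nhdsWithin_le_nhds hfg] with t ht
  rw [ht, h0]

theorem DirDeriv.add [ContinuousAdd Y] {f g : E → Y} {x y : E} {L L' : Y} (h : DirDeriv f x y L)
    (h' : DirDeriv g x y L') : DirDeriv (fun p => f p + g p) x y (L + L') := by
  refine (Tendsto.add h h').congr fun t => ?_
  rw [← smul_add, add_sub_add_comm]

theorem dirDeriv_const (c : Y) (x y : E) : DirDeriv (fun _ => c) x y 0 := by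
  simp [DirDeriv, tendsto_const_nhds]

theorem DirDeriv.unique [T2Space Y] {f : E → Y} {x y : E} {L L' : Y} (h : DirDeriv f x y L)
    (h' : DirDeriv f x y L') : L = L' := tendsto_nhds_unique h h'

theorem DirDeriv.smul [ContinuousSMul ℝ Y] [ContinuousAdd Y] {u : E → ℝ} {f : E → Y} {x y : E} {a : ℝ} {L : Y}
    (hu : DirDeriv u x y a) (hf : DirDeriv f x y L)
    (hc : Tendsto (fun t : ℝ => f (x + t • y)) (𝓝 0) (𝓝 (f x))) :
    DirDeriv (fun p => u p • f p) x y (a • f x + u x • L) := by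
  refine ((Tendsto.smul hu (hc.mono_left nhdsWithin_le_nhds)).add
    (Tendsto.const_smul hf (u x))).congr fun t => ?_
  simp only [smul_eq_mul]
  module

theorem DirDeriv.comp_affine {E' : Type*} [AddCommGroup E'] [Module ℝ E'] {f : E' → Y}
    (π : E →ᵃ[ℝ] E') {x y : E} {L : Y} (h : DirDeriv f (π x) (π.linear y) L) :
    DirDeriv (fun p => f (π p)) x y L := by
  refine Tendsto.congr (fun t => ?_) h
  have : π (x + t • y) = π x + t • π.linear y := by
    have := π.map_vadd x (t • y)
    rw [vadd_eq_add, vadd_eq_add, map_smul, add_comm, add_comm _ (π x)] at this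
    exact this
  simp only [this]

variable [IsTopologicalAddGroup Y] [ContinuousSMul ℝ Y] [LocallyConvexSpace ℝ Y]

/-- The mean value theorem for curves in a locally convex space. -/
theorem slope_mem_of_deriv_mem {γ γ' : ℝ → Y} {a b : ℝ} (hab : a < b)
    (hγ : ∀ t ∈ Icc a b, DirDeriv γ t 1 (γ' t)) {W : Set Y} (hW : Convex ℝ W) (hWc : IsClosed W)
    (hγ' : ∀ t ∈ Icc a b, γ' t ∈ W) : (b - a)⁻¹ • (γ b - γ a) ∈ W := by
  by_contra hn
  -- A functional separating the slope from `W` would contradict the real mean value theorem.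
  obtain ⟨φ, u, hu, hb⟩ := geometric_hahn_banach_point_closed hW hWc hn
  have hd : ∀ t ∈ Icc a b, HasDerivAt (fun s => φ (γ s)) (φ (γ' t)) t := by
    intro t ht
    rw [hasDerivAt_iff_tendsto_slope_zero]
    refine ((φ.continuous.tendsto _).comp (hγ t ht)).congr fun s => ?_
    simp
  obtain ⟨c, hc, hc'⟩ := exists_hasDerivAt_eq_slope (fun s => φ (γ s)) (fun t => φ (γ' t)) hab
    (fun t ht => (hd t ht).continuousAt.continuousWithinAt)
    (fun t ht => hd t (Ioo_subset_Icc_self ht))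
  have h1 := hb _ (hγ' c (Ioo_subset_Icc_self hc))
  rw [hc', div_eq_inv_mul] at h1
  simp only [map_smul, map_sub, smul_eq_mul] at hu
  linarith

theorem exists_closed_convex_subset_nhds {L : Y} {W : Set Y} (hW : W ∈ 𝓝 L) :
    ∃ C ∈ 𝓝 L, Convex ℝ C ∧ IsClosed C ∧ C ⊆ W := by
  obtain ⟨C, hC, hCc, hCW⟩ := exists_mem_nhds_isClosed_subset hW
  obtain ⟨D, ⟨hD, hDc⟩, hDC⟩ := (LocallyConvexSpace.convex_basis (𝕜 := ℝ) L).mem_iff.1 hC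
  exact ⟨closure D, mem_of_superset hD subset_closure, hDc.closure, isClosed_closure,
    (closure_minimal hDC hCc).trans hCW⟩

variable [TopologicalSpace E] [IsTopologicalAddGroup E] [ContinuousSMul ℝ E] [T2Space E]
  [FiniteDimensional ℝ E]

/-- If the directional derivative of `f` exists in the relative interior of a convex set and
extends continuously, then the extension describes the directional derivative also at the boundary
points that are interior to a segment in the given direction. -/
theorem dirDeriv_of_intrinsicInterior {Q : Set E} (hQ : Convex ℝ Q) {f g : E → Y} {p y : E}
    (hf : ContinuousOn f Q) (hg : ContinuousOn g Q)
    (h : ∀ x ∈ intrinsicInterior ℝ Q, DirDeriv f x y (g x))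
    (hp : ∀ᶠ t : ℝ in 𝓝 0, p + t • y ∈ Q) : DirDeriv f p y (g p) := by
  have hpQ : p ∈ Q := by simpa using hp.self_of_nhds
  obtain ⟨z, hz⟩ := intrinsicInterior_nonempty_of_convex hQ ⟨p, hpQ⟩
  intro W hW
  obtain ⟨C, hC, hCc, hCcl, hCW⟩ := exists_closed_convex_subset_nhds hW
  have hgp : ∀ᶠ x in 𝓝 p, x ∈ Q → g x ∈ C :=
    eventually_nhdsWithin_iff.1 ((hg p hpQ).eventually hC)
  have hcont : Continuous fun q : ℝ × ℝ => p + q.1 • (z - p) + q.2 • y := by fun_prop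
  have ht0 := hcont.tendsto (0, 0)
  simp only [zero_smul, add_zero] at ht0
  obtain ⟨ε, hε, hεg⟩ := Metric.eventually_nhds_iff.1 (ht0.eventually hgp)
  obtain ⟨δ, hδ, hδp⟩ := Metric.eventually_nhds_iff.1 hp
  -- The point is a convex combination of `z` and `p + (t / (1 - s)) • y`; since `s ≤ 1 / 2` and
  -- `|t| < δ / 2`, the latter is still in `Q`.
  have hri : ∀ s t : ℝ, 0 < s → s ≤ 1 / 2 → |t| < δ / 2 →
      p + s • (z - p) + t • y ∈ intrinsicInterior ℝ Q := by
    intro s t hs hs1 ht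
    have h1 : 0 < 1 - s := by linarith
    have hmem : p + (t / (1 - s)) • y ∈ Q := by
      apply hδp
      rw [Real.dist_eq, sub_zero, abs_div, abs_of_pos h1, div_lt_iff₀ h1]
      nlinarith
    convert combo_mem_intrinsicInterior hQ hz hmem hs (by linarith) using 1
    have h2 : t = (1 - s) * (t / (1 - s)) := by field_simp
    nth_rw 1 [h2]
    module
  have hη : 0 < min ε (δ / 2) := by positivity
  -- Difference quotients along the segment shifted by `s` into the relative interior lie in `C`. As
  -- `C` is closed, letting `s → 0` yields those at `p`.
  have hmain : ∀ t : ℝ, t ≠ 0 → |t| < min ε (δ / 2) → ∀ s : ℝ, 0 < s → s < min ε (1 / 2) →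
      t⁻¹ • (f (p + s • (z - p) + t • y) - f (p + s • (z - p))) ∈ C := by
    intro t ht0 ht s hs hs1
    have hs2 : s < ε := hs1.trans_le (min_le_left _ _)
    have hs3 : s ≤ 1 / 2 := hs1.le.trans (min_le_right _ _)
    have hder : ∀ τ : ℝ, |τ| ≤ |t| → DirDeriv (fun τ : ℝ => f (p + s • (z - p) + τ • y)) τ 1
        (g (p + s • (z - p) + τ • y)) ∧ g (p + s • (z - p) + τ • y) ∈ C := by
      intro τ hτ
      have hτ' : |τ| < min ε (δ / 2) := hτ.trans_lt ht
      have hr := hri s τ hs hs3 (hτ'.trans_le (min_le_right _ _))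
      constructor
      · refine (h _ hr).congr' ?_
        filter_upwards with r
        rw [smul_eq_mul, mul_one, add_smul, add_assoc]
      · refine hεg (y := (s, τ)) ?_ (intrinsicInterior_subset hr)
        rw [Prod.dist_eq, max_lt_iff]
        simp only [Real.dist_eq, sub_zero, abs_of_pos hs]
        exact ⟨hs2, hτ'.trans_le (min_le_left _ _)⟩
    rcases lt_or_gt_of_ne ht0 with htn | htp
    · have := slope_mem_of_deriv_mem htn
        (fun τ hτ => (hder τ (by rw [abs_of_nonpos hτ.2, abs_of_neg htn]; linarith [hτ.1])).1)
        hCc hCcl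
        (fun τ hτ => (hder τ (by rw [abs_of_nonpos hτ.2, abs_of_neg htn]; linarith [hτ.1])).2)
      simp only [zero_smul, add_zero, zero_sub] at this
      rw [inv_neg, neg_smul, ← smul_neg, neg_sub] at this
      exact this
    · have := slope_mem_of_deriv_mem htp
        (fun τ hτ => (hder τ (by rw [abs_of_nonneg hτ.1, abs_of_pos htp]; exact hτ.2)).1)
        hCc hCcl
        (fun τ hτ => (hder τ (by rw [abs_of_nonneg hτ.1, abs_of_pos htp]; exact hτ.2)).2)
      simpa only [zero_smul, add_zero, sub_zero] using this
  have key : ∀ t : ℝ, |t| < δ / 2 →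
      Tendsto (fun s : ℝ => f (p + s • (z - p) + t • y)) (𝓝[>] 0) (𝓝 (f (p + t • y))) := by
    intro t ht
    have hq : p + t • y ∈ Q := hδp (by rw [Real.dist_eq, sub_zero]; linarith)
    refine (hf _ hq).tendsto.comp (tendsto_nhdsWithin_iff.2 ⟨?_, ?_⟩)
    · have hc : Continuous fun s : ℝ => p + s • (z - p) + t • y := by fun_prop
      have := hc.tendsto 0
      simp only [zero_smul, add_zero] at this
      exact this.mono_left nhdsWithin_le_nhds
    · filter_upwards [Ioc_mem_nhdsGT (show (0 : ℝ) < 1 / 2 by norm_num)] with s hs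
      exact intrinsicInterior_subset (hri s t hs.1 hs.2 ht)
  refine mem_map.2 (mem_of_superset (x := {t | |t| < min ε (δ / 2)} ∩ {0}ᶜ) ?_ ?_)
  · refine inter_mem (nhdsWithin_le_nhds ?_) self_mem_nhdsWithin
    filter_upwards [Metric.ball_mem_nhds (0 : ℝ) hη] with t ht
    simpa [Real.dist_eq] using ht
  · rintro t ⟨ht, ht0⟩
    refine hCW (hCcl.mem_of_tendsto (b := 𝓝[>] (0 : ℝ)) (((key t ?_).sub
      (by simpa using key 0 (by simpa using hδ))).const_smul t⁻¹) ?_)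
    · exact lt_of_lt_of_le ht (min_le_right _ _)
    · filter_upwards [Ioo_mem_nhdsGT (show (0 : ℝ) < min ε (1 / 2) by positivity)] with s hs
      exact hmain t ht0 ht s hs.1 hs.2

end MeanValue

/-! ### Continuous families of differentiable functions -/

section Families

universe u v w

variable {E : Type u} [AddCommGroup E] [Module ℝ E] [TopologicalSpace E]
variable {Y : Type v} [AddCommGroup Y] [Module ℝ Y] [TopologicalSpace Y]

/-- `f : X → E → Y` is a continuous family of `C^k`-functions on `M`: it is jointly continuous on
`X × M`, and (for `k > 0`) its directional derivatives in the relative interior of `M` extend to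
a continuous family of `C^(k-1)`-functions, with parameters in `X` and in the directions. -/
def CkFam (M : Set E) : ℕ → ∀ (X : Type (max u w)) [TopologicalSpace X], (X → E → Y) → Prop
  | 0, _, _, f => ContinuousOn (Function.uncurry f) (univ ×ˢ M)
  | k + 1, X, _, f => ContinuousOn (Function.uncurry f) (univ ×ˢ M) ∧
      ∃ g : X × dir M → E → Y, CkFam M k (X × dir M) g ∧
        ∀ x, ∀ y : dir M, ∀ p ∈ intrinsicInterior ℝ M, DirDeriv (f x) p y (g (x, y) p)

variable {M : Set E} {X : Type (max u w)} [TopologicalSpace X] {k : ℕ}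

theorem CkFam.continuousOn {f : X → E → Y} (h : CkFam.{u, v, w} M k X f) :
    ContinuousOn (Function.uncurry f) (univ ×ˢ M) := by
  cases k with
  | zero => exact h
  | succ k => exact h.1

theorem CkFam.continuousOn_apply {f : X → E → Y} (h : CkFam.{u, v, w} M k X f) (x : X) :
    ContinuousOn (f x) M :=
  h.continuousOn.comp (f := fun p => (x, p)) (by fun_prop) fun p hp => ⟨mem_univ _, hp⟩

theorem CkFam.of_succ {f : X → E → Y} (h : CkFam.{u, v, w} M (k + 1) X f) :
    CkFam.{u, v, w} M k X f := by
  induction k generalizing X with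
  | zero => exact h.1
  | succ k ih =>
    obtain ⟨hc, g, hg, hd⟩ := h
    exact ⟨hc, g, ih hg, hd⟩

theorem CkFam.congr {f f' : X → E → Y} (h : CkFam.{u, v, w} M k X f)
    (hff : ∀ x, ∀ p ∈ M, f x p = f' x p) (hri : ∀ p ∈ intrinsicInterior ℝ M, ∀ y ∈ dir M,
      ∀ᶠ t : ℝ in 𝓝 0, p + t • y ∈ intrinsicInterior ℝ M) : CkFam.{u, v, w} M k X f' := by
  have hc : ContinuousOn (Function.uncurry f') (univ ×ˢ M) :=
    h.continuousOn.congr fun q hq => (hff q.1 q.2 hq.2).symm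
  cases k with
  | zero => exact hc
  | succ k =>
    obtain ⟨-, g, hg, hd⟩ := h
    refine ⟨hc, g, hg, fun x y p hp => (hd x y p hp).congr ?_⟩
    filter_upwards [hri p hp y y.2] with t ht
    exact hff x _ (intrinsicInterior_subset ht)

theorem CkFam.comp_param {X' : Type (max u w)} [TopologicalSpace X'] {f : X → E → Y}
    (h : CkFam.{u, v, w} M k X f) {φ : X' → X} (hφ : Continuous φ) :
    CkFam.{u, v, w} M k X' (fun x => f (φ x)) := by
  induction k generalizing X X' with
  | zero =>
    exact ContinuousOn.comp (g := Function.uncurry f) (f := fun q : X' × E => (φ q.1, q.2))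
      h (by fun_prop) fun q hq => ⟨mem_univ _, hq.2⟩
  | succ k ih =>
    obtain ⟨hc, g, hg, hd⟩ := h
    refine ⟨ContinuousOn.comp (g := Function.uncurry f) (f := fun q : X' × E => (φ q.1, q.2))
      hc (by fun_prop) fun q hq => ⟨mem_univ _, hq.2⟩, fun q => g (φ q.1, q.2),
      ih hg (φ := fun q : X' × dir M => (φ q.1, q.2)) (by fun_prop), fun x y p hp => hd (φ x) y p hp⟩

theorem ckFam_of_continuous {c : X → Y} (hc : Continuous c) :
    CkFam.{u, v, w} M k X (fun x (_ : E) => c x) := by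
  induction k generalizing X with
  | zero => exact (hc.comp continuous_fst).continuousOn
  | succ k ih =>
    refine ⟨(hc.comp continuous_fst).continuousOn, fun _ _ => 0, ih continuous_const,
      fun x y p _ => dirDeriv_const _ _ _⟩

variable [IsTopologicalAddGroup Y] [ContinuousSMul ℝ Y]

theorem CkFam.add {f f' : X → E → Y} (h : CkFam.{u, v, w} M k X f)
    (h' : CkFam.{u, v, w} M k X f') : CkFam.{u, v, w} M k X (fun x p => f x p + f' x p) := by
  induction k generalizing X with
  | zero => exact ContinuousOn.add h h'
  | succ k ih =>
    obtain ⟨hc, g, hg, hd⟩ := h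
    obtain ⟨hc', g', hg', hd'⟩ := h'
    exact ⟨hc.add hc', _, ih hg hg', fun x y p hp => (hd x y p hp).add (hd' x y p hp)⟩

theorem CkFam.sum {ι : Type*} (s : Finset ι) {f : ι → X → E → Y}
    (h : ∀ i ∈ s, CkFam.{u, v, w} M k X (f i)) :
    CkFam.{u, v, w} M k X (fun x p => ∑ i ∈ s, f i x p) := by
  classical
  induction s using Finset.induction_on with
  | empty => simpa using ckFam_of_continuous (X := X) (M := M) (Y := Y) (c := fun _ => 0) continuous_const
  | insert a s ha ih =>
    simp only [Finset.sum_insert ha]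
    exact (h a (by simp)).add (ih fun i hi => h i (by simp [hi]))

variable [IsTopologicalAddGroup E] [ContinuousSMul ℝ E]

theorem tendsto_dir_of_continuousOn {f : E → Y} {p y : E} (hf : ContinuousOn f M) (hp : p ∈ M)
    (h : ∀ᶠ t : ℝ in 𝓝 0, p + t • y ∈ M) :
    Tendsto (fun t : ℝ => f (p + t • y)) (𝓝 0) (𝓝 (f p)) :=
  (hf p hp).tendsto.comp (tendsto_nhdsWithin_iff.2 ⟨tendsto_add_smul_nhds_zero p y, h⟩)

theorem CkFam.smul {u : X → E → ℝ} {f : X → E → Y} (hu : CkFam.{u, 0, w} M k X u)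
    (hf : CkFam.{u, v, w} M k X f) : CkFam.{u, v, w} M k X (fun x p => u x p • f x p) := by
  induction k generalizing X with
  | zero => exact ContinuousOn.smul hu hf
  | succ k ih =>
    have hu' := hu.of_succ
    have hf' := hf.of_succ
    obtain ⟨hc, g, hg, hd⟩ := hu
    obtain ⟨hc', g', hg', hd'⟩ := hf
    refine ⟨hc.smul hc', _, (ih hg (hf'.comp_param (continuous_fst (Y := dir M)))).add
      (ih (hu'.comp_param (continuous_fst (Y := dir M))) hg'), fun x y p hp => ?_⟩
    refine (hd x y p hp).smul (hd' x y p hp) (tendsto_dir_of_continuousOn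
      (hf'.continuousOn_apply x) (intrinsicInterior_subset hp) ?_)
    exact (eventually_add_smul_mem_intrinsicInterior hp y.2).mono
      fun t ht => intrinsicInterior_subset ht

theorem CkFam.sub {f f' : X → E → Y} (h : CkFam.{u, v, w} M k X f)
    (h' : CkFam.{u, v, w} M k X f') : CkFam.{u, v, w} M k X (fun x p => f x p - f' x p) := by
  have h1 : CkFam.{u, 0, w} M k X (fun _ _ => (-1 : ℝ)) := ckFam_of_continuous continuous_const
  simpa [sub_eq_add_neg] using h.add (h1.smul h')

/-- Smooth functions on a normed space with coordinates in `E` yield families of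
`C^k`-functions. -/
theorem ckFam_of_contDiff {N : Type} [NormedAddCommGroup N] [NormedSpace ℝ N] (e : E →L[ℝ] N)
    {W : Type} [NormedAddCommGroup W] [NormedSpace ℝ W] {U : W × N → ℝ}
    (hU : ContDiff ℝ (⊤ : ℕ∞) U) {φ : X → W} (hφ : Continuous φ) :
    CkFam.{u, 0, w} M k X (fun x p => U (φ x, e p)) := by
  have hc : ∀ {X : Type (max u w)} [TopologicalSpace X] {W : Type} [NormedAddCommGroup W]
      {U : W × N → ℝ} (_ : Continuous U) {φ : X → W} (_ : Continuous φ),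
      ContinuousOn (Function.uncurry fun x p => U (φ x, e p)) (univ ×ˢ M) := by
    intro X _ W _ U hU φ hφ
    exact (hU.comp (by fun_prop : Continuous fun q : X × E => (φ q.1, e q.2))).continuousOn
  induction k generalizing X W with
  | zero => exact hc hU.continuous hφ
  | succ k ih =>
    -- The direction of differentiation becomes a further parameter, so `W` grows to `W × N`.
    refine ⟨hc hU.continuous hφ, _, ih (X := X × dir M) (W := W × N)
      (U := fun q => fderiv ℝ U (q.1.1, q.2) (0, q.1.2))
      (φ := fun q => (φ q.1, e q.2)) ?_ (by fun_prop), fun x y p _ => ?_⟩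
    · have h1 : ContDiff ℝ (⊤ : ℕ∞) (fderiv ℝ U) := hU.fderiv_right (by simp)
      exact (h1.comp (by fun_prop)).clm_apply (by fun_prop)
    · have h1 : HasFDerivAt U (fderiv ℝ U (φ x, e p)) ((φ x, e p) + (0 : ℝ) • ((0 : W), e y)) := by
        rw [zero_smul, add_zero]
        exact (hU.differentiable (by simp)).differentiableAt.hasFDerivAt
      have h2 : HasDerivAt (fun t : ℝ => (φ x, e p) + t • ((0 : W), e y)) (0, e y) 0 := by
        simpa using ((hasDerivAt_id (0 : ℝ)).smul_const ((0 : W), e y)).const_add (φ x, e p)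
      have h3 := h1.comp_hasDerivAt (0 : ℝ) h2
      rw [hasDerivAt_iff_tendsto_slope_zero] at h3
      refine h3.congr fun t => ?_
      simp

variable [T2Space E] [FiniteDimensional ℝ E] [T2Space Y] [LocallyConvexSpace ℝ Y]

/-- Pull-backs along an affine map, multiplied with a cut-off function which vanishes where the
affine map may leave the domain. -/
theorem CkFam.pullback {P Q : Set E} (hP : Convex ℝ P) (hQ : Convex ℝ Q) (π : E →ᵃ[ℝ] E)
    (hπ : ∀ y ∈ dir P, π.linear y ∈ dir Q) {O₁ O₂ : Set E} (hO₁ : IsOpen O₁) (hO₂ : IsOpen O₂)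
    (hO : ∀ p ∈ P, p ∈ O₁ ∨ p ∈ O₂) (hPQ : ∀ p ∈ P, p ∈ O₁ → π p ∈ Q)
    {u : X → E → ℝ} {f : X → E → Y} (hu : CkFam.{u, 0, w} P k X u)
    (hu0 : ∀ x, ∀ p ∈ P, p ∈ O₂ → u x p = 0) (hf : CkFam.{u, v, w} Q k X f) :
    CkFam.{u, v, w} P k X (fun x p => u x p • f x (π p)) := by
  have hπc : Continuous π := by
    rw [π.decomp]
    exact π.linear.continuous_of_finiteDimensional.add continuous_const
  have hcont : ∀ {X : Type (max u w)} [TopologicalSpace X] {u : X → E → ℝ} {f : X → E → Y},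
      ContinuousOn (Function.uncurry u) (univ ×ˢ P) →
      (∀ x, ∀ p ∈ P, p ∈ O₂ → u x p = 0) → ContinuousOn (Function.uncurry f) (univ ×ˢ Q) →
      ContinuousOn (Function.uncurry fun x p => u x p • f x (π p)) (univ ×ˢ P) := by
    rintro X _ u f hu hu0 hf ⟨x, p⟩ hp
    rcases hO p hp.2 with h | h
    · refine ContinuousWithinAt.smul (hu _ hp) ?_
      have h1 : Tendsto (fun q : X × E => (q.1, π q.2)) (𝓝[univ ×ˢ P] (x, p))
          (𝓝[univ ×ˢ Q] (x, π p)) := by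
        refine tendsto_nhdsWithin_iff.2 ⟨?_, ?_⟩
        · have : Continuous fun q : X × E => (q.1, π q.2) := by fun_prop
          exact (this.tendsto (x, p)).mono_left nhdsWithin_le_nhds
        · have : Prod.snd ⁻¹' O₁ ∈ 𝓝 (x, p) :=
            (hO₁.preimage continuous_snd).mem_nhds h
          filter_upwards [self_mem_nhdsWithin, nhdsWithin_le_nhds this] with q hq hq'
          exact ⟨mem_univ _, hPQ _ hq.2 hq'⟩
      exact (hf (x, π p) ⟨mem_univ _, hPQ p hp.2 h⟩).tendsto.comp h1
    · have h0 : ∀ q : X × E, q ∈ (univ : Set X) ×ˢ P → q.2 ∈ O₂ →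
          Function.uncurry (fun x p => u x p • f x (π p)) q = 0 := by
        intro q hq hq'
        simp [Function.uncurry, hu0 q.1 q.2 hq.2 hq']
      refine (continuousWithinAt_const (b := (0 : Y))).congr_of_eventuallyEq ?_ (h0 _ hp h)
      have : Prod.snd ⁻¹' O₂ ∈ 𝓝 (x, p) := (hO₂.preimage continuous_snd).mem_nhds h
      filter_upwards [self_mem_nhdsWithin, nhdsWithin_le_nhds this] with q hq hq'
      exact h0 q hq hq'
  induction k generalizing X with
  | zero => exact hcont hu hu0 hf
  | succ k ih =>
    have hu' := hu.of_succ
    have hf' := hf.of_succ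
    obtain ⟨hc, g, hg, hd⟩ := hu
    obtain ⟨hc', g', hg', hd'⟩ := hf
    have hzero : ∀ x : X, ∀ p ∈ intrinsicInterior ℝ P, p ∈ O₂ → ∀ y ∈ dir P,
        ∀ᶠ t : ℝ in 𝓝 0, u x (p + t • y) = 0 := by
      intro x p hp hp2 y hy
      filter_upwards [eventually_add_smul_mem_intrinsicInterior hp hy,
        (tendsto_add_smul_nhds_zero p y).eventually (hO₂.mem_nhds hp2)] with t ht ht'
      exact hu0 x _ (intrinsicInterior_subset ht) ht'
    -- The derivatives of `u` vanish on `O₂` too: in the relative interior because `u` is zero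
    -- nearby, elsewhere by continuity. This lets the induction run on both terms of the product
    -- rule.
    have hg0 : ∀ q : X × dir P, ∀ p ∈ P, p ∈ O₂ → g q p = 0 := by
      rintro ⟨x, y⟩
      refine eqOn_of_eqOn_intrinsicInterior hP hO₂ (hg.continuousOn_apply _) continuousOn_const ?_
      intro p hp hp2
      refine (hd x y p hp).unique ((dirDeriv_const 0 p y).congr ?_)
      filter_upwards [hzero x p hp hp2 y y.2] with t ht
      exact ht.symm
    refine ⟨hcont hc hu0 hc', _,
      (ih hg hg0 (hf'.comp_param (continuous_fst (Y := dir P)))).add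
      (ih (hu'.comp_param (continuous_fst (Y := dir P))) (fun q => hu0 q.1)
      (hg'.comp_param (φ := fun q : X × dir P => (q.1, (⟨π.linear q.2, hπ _ q.2.2⟩ : dir Q))) ?_)),
      fun x y p hp => ?_⟩
    · have : Continuous π.linear := π.linear.continuous_of_finiteDimensional
      fun_prop
    · have hpP := intrinsicInterior_subset hp
      have hev := eventually_add_smul_mem_intrinsicInterior hp y.2
      rcases hO p hpP with h | h
      · have hevQ : ∀ᶠ t : ℝ in 𝓝 0, π p + t • π.linear y ∈ Q := by
          filter_upwards [hev, (tendsto_add_smul_nhds_zero p (y : E)).eventually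
            (hO₁.mem_nhds h)] with t ht ht'
          have h1 := hPQ _ (intrinsicInterior_subset ht) ht'
          have h2 := π.map_vadd p (t • (y : E))
          rw [vadd_eq_add, vadd_eq_add, map_smul, add_comm, add_comm _ (π p)] at h2
          rwa [← h2]
        -- `π p` may be a boundary point of `Q`, but `Q` contains a segment around it in direction
        -- `π.linear y`.
        have hdf : DirDeriv (f x) (π p) (π.linear y) (g' (x, ⟨π.linear y, hπ _ y.2⟩) (π p)) :=
          dirDeriv_of_intrinsicInterior hQ (hf'.continuousOn_apply x)
            (hg'.continuousOn_apply _)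
            (fun q hq => hd' x ⟨π.linear y, hπ _ y.2⟩ q hq) hevQ
        refine (hd x y p hp).smul (hdf.comp_affine π) ?_
        have h3 := tendsto_dir_of_continuousOn (hf'.continuousOn_apply x) (hPQ p hpP h) hevQ
        refine h3.congr fun t => ?_
        have h2 := π.map_vadd p (t • (y : E))
        rw [vadd_eq_add, vadd_eq_add, map_smul, add_comm, add_comm _ (π p)] at h2
        rw [h2]
      · simp only [hg0 (x, y) p hpP h, hu0 x p hpP h, zero_smul, add_zero]
        refine (dirDeriv_const 0 p (y : E)).congr ?_
        filter_upwards [hzero x p hp h y y.2] with t ht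
        rw [ht, zero_smul]

end Families

/-! ### Families of functions versus continuous maps into `Cm` -/

section Bridge

universe u v w

variable {E : Type u} {Y : Type v} [AddCommGroup Y]

theorem extendZero_apply {M : Set E} (g : M → Y) {x : E} (hx : x ∈ M) :
    extendZero g x = g ⟨x, hx⟩ :=
  Subtype.val_injective.extend_apply g (0 : E → Y) ⟨x, hx⟩

theorem extendZero_coe {M : Set E} (g : M → Y) (x : M) : extendZero g x = g x :=
  extendZero_apply g x.2

theorem continuousOn_extendZero [TopologicalSpace E] [TopologicalSpace Y] {M : Set E} {g : M → Y}
    (hg : Continuous g) : ContinuousOn (extendZero g) M := by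
  rw [continuousOn_iff_continuous_domRestrict]
  convert hg using 1
  exact funext fun x => extendZero_coe g x

variable [AddCommGroup E] [Module ℝ E] [TopologicalSpace E]
variable [Module ℝ Y] [TopologicalSpace Y]
variable [IsTopologicalAddGroup E] [ContinuousSMul ℝ E]

theorem hasDirDerivAt_congr {M : Set E} {g g' : M → Y} {x y : E} {L : Y}
    (h : HasDirDerivAt g x y L) (hx : x ∈ intrinsicInterior ℝ M) (hy : y ∈ dir M)
    (hg : ∀ z : M, (z : E) ∈ intrinsicInterior ℝ M → g z = g' z) : HasDirDerivAt g' x y L := by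
  refine DirDeriv.congr (f := extendZero g) h ?_
  filter_upwards [eventually_add_smul_mem_intrinsicInterior hx hy] with t ht
  have htM := intrinsicInterior_subset ht
  rw [extendZero_apply g htM, extendZero_apply g' htM]
  exact hg _ ht

/-- The lower-order derivative in the recursion is existentially quantified and free off the
relative interior; difference quotients at relative interior points do not see that freedom. -/
theorem IsIterDirDeriv.unique [T2Space Y] {M : Set E} {f : M → Y} {k : ℕ}
    {d d' : M × (Fin k → dir M) → Y} (h : IsIterDirDeriv f k d) (h' : IsIterDirDeriv f k d')
    (x : M) (hx : (x : E) ∈ intrinsicInterior ℝ M) (y : Fin k → dir M) : d (x, y) = d' (x, y) := by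
  induction k generalizing x with
  | zero => rw [h x hx y, h' x hx y]
  | succ k ih =>
    obtain ⟨e, he, hd⟩ := h
    obtain ⟨e', he', hd'⟩ := h'
    exact tendsto_nhds_unique (hasDirDerivAt_congr (hd x hx y) hx (y (Fin.last k)).2
      fun z hz => ih he he' z hz _) (hd' x hx y)

/-- Iterated directional derivatives may also be computed by taking the derivative in the first
direction first. -/
theorem isIterDirDeriv_succ_of_first {M : Set E} {f : M → Y} {g : dir M → M → Y}
    (hg : ∀ y : dir M, ∀ x : M, (x : E) ∈ intrinsicInterior ℝ M → HasDirDerivAt f x y (g y x))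
    {k : ℕ} {D : dir M → M × (Fin k → dir M) → Y} (hD : ∀ y, IsIterDirDeriv (g y) k (D y)) :
    IsIterDirDeriv f (k + 1) (fun q => D (q.2 0) (q.1, Fin.tail q.2)) := by
  induction k with
  | zero =>
    refine ⟨fun q => f q.1, fun _ _ _ => rfl, fun x hx y => ?_⟩
    dsimp only
    rw [hD (y 0) x hx]
    exact hg (y 0) x hx
  | succ k ih =>
    choose D' hD' hd using hD
    refine ⟨_, ih hD', fun x hx y => ?_⟩
    have h := hd (y 0) x hx (Fin.tail y)
    rw [← Fin.tail_init_eq_init_tail] at h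
    exact h

variable {M : Set E} {X : Type (max u w)} [TopologicalSpace X]

/-- `CkFam` peels off the first direction and `IsIterDirDeriv` the last, so the two are matched by
`isIterDirDeriv_succ_of_first`. -/
theorem CkFam.exists_isIterDirDeriv {k : ℕ} {f : X → E → Y} (h : CkFam.{u, v, w} M k X f) :
    ∃ D : X × (M × (Fin k → dir M)) → Y, Continuous D ∧
      ∀ x, IsIterDirDeriv (fun z : M => f x z) k (fun q => D (x, q)) := by
  induction k generalizing X with
  | zero =>
    refine ⟨fun q => f q.1 q.2.1, ?_, fun x _ _ _ => rfl⟩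
    exact ContinuousOn.comp_continuous (g := Function.uncurry f)
      (f := fun q : X × (M × (Fin 0 → dir M)) => (q.1, (q.2.1 : E))) h (by fun_prop)
      fun q => ⟨mem_univ _, q.2.1.2⟩
  | succ k ih =>
    obtain ⟨-, g, hg, hd⟩ := h
    obtain ⟨D, hD, hDi⟩ := ih hg
    refine ⟨fun q => D ((q.1, q.2.2 0), (q.2.1, Fin.tail q.2.2)), ?_, fun x => ?_⟩
    · refine hD.comp ?_
      have : Continuous fun q : X × (M × (Fin (k + 1) → dir M)) => Fin.tail q.2.2 :=
        continuous_pi fun i => by unfold Fin.tail; fun_prop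
      fun_prop
    · refine isIterDirDeriv_succ_of_first (g := fun y z => g (x, y) z) (fun y z hz => ?_)
        (D := fun y q => D ((x, y), q)) fun y => hDi (x, y)
      refine DirDeriv.congr (hd x y z hz) ?_
      filter_upwards [eventually_add_smul_mem_intrinsicInterior hz y.2] with t ht
      rw [extendZero_apply _ (intrinsicInterior_subset ht)]

variable [T2Space E] [FiniteDimensional ℝ E]

theorem eq_of_eq_intrinsicInterior [T2Space Y] (hM : Convex ℝ M) {a b : M → Y}
    (ha : Continuous a) (hb : Continuous b)
    (h : ∀ z : M, (z : E) ∈ intrinsicInterior ℝ M → a z = b z) : a = b := by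
  funext z
  have := eqOn_of_eqOn_intrinsicInterior hM isOpen_univ (continuousOn_extendZero ha)
    (continuousOn_extendZero hb) (fun x hx _ => by
      rw [extendZero_apply a (intrinsicInterior_subset hx),
        extendZero_apply b (intrinsicInterior_subset hx)]
      exact h _ hx) z z.2 (mem_univ _)
  rwa [extendZero_coe, extendZero_coe] at this

theorem IsIterDirDeriv.unique_continuous [T2Space Y] (hM : Convex ℝ M) {f : M → Y} {k : ℕ}
    {d d' : M × (Fin k → dir M) → Y} (h : IsIterDirDeriv f k d) (h' : IsIterDirDeriv f k d')
    (hd : Continuous d) (hd' : Continuous d') : d = d' := by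
  funext ⟨x, y⟩
  exact congrFun (eq_of_eq_intrinsicInterior hM (a := fun z => d (z, y)) (b := fun z => d' (z, y))
    (by fun_prop) (by fun_prop) fun z hz => h.unique h' z hz y) x

variable [IsTopologicalAddGroup Y] [ContinuousSMul ℝ Y] {m : ℕ∞}

theorem Cm.isIterDirDeriv_d {k : ℕ} (hk : (k : ℕ∞) ≤ m) (f : Cm m M Y) :
    IsIterDirDeriv (f : M → Y) k (Cm.d k hk f) := (f.2.2 k hk).choose_spec

theorem Cm.continuous_d {k : ℕ} (hk : (k : ℕ∞) ≤ m) :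
    Continuous (Cm.d k hk : Cm m M Y → C(M × (Fin k → dir M), Y)) :=
  continuous_iInf_dom (continuous_iInf_dom continuous_induced_dom)

omit [IsTopologicalAddGroup Y] [ContinuousSMul ℝ Y] in
theorem locallyCompactSpace_dir (M : Set E) : LocallyCompactSpace (dir M) :=
  (ContinuousLinearEquiv.ofFinrankEq (𝕜 := ℝ) (E := dir M)
    (F := Fin (Module.finrank ℝ (dir M)) → ℝ) (by simp)).toHomeomorph.isClosedEmbedding.locallyCompactSpace

/-- A continuous map to a space of `C^m`-functions is a continuous family of `C^k`-functions. -/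
theorem ckFam_of_continuous_cm [T2Space Y] (hM : Convex ℝ M) (hMc : IsCompact M)
    {c : X → Cm m M Y} (hc : Continuous c) {k : ℕ} (hk : (k : ℕ∞) ≤ m) :
    CkFam.{u, v, w} M k X (fun x => extendZero (c x)) := by
  have := isCompact_iff_compactSpace.1 hMc
  have := locallyCompactSpace_dir M
  have hcont : ∀ (j : ℕ) (hj : (j : ℕ∞) ≤ m), ContinuousOn (Function.uncurry
      fun (q : X × (Fin j → dir M)) => extendZero fun z : M => Cm.d j hj (c q.1) (z, q.2))
      (univ ×ˢ M) := by
    intro j hj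
    rw [continuousOn_iff_continuous_domRestrict]
    -- Evaluation of continuous maps is jointly continuous because `M × (Fin j → dir M)` is locally
    -- compact.
    have h1 : Continuous fun s : ((univ : Set (X × (Fin j → dir M))) ×ˢ M : Set _) =>
        Cm.d j hj (c s.1.1.1) ((⟨s.1.2, s.2.2⟩ : M), s.1.1.2) := by
      refine Continuous.eval ((Cm.continuous_d hj).comp (hc.comp (by fun_prop))) ?_
      fun_prop
    convert h1 using 1
    funext s
    exact extendZero_apply (fun z : M => Cm.d j hj (c s.1.1.1) (z, s.1.1.2)) s.2.2
  -- The induction is on the number of derivatives still to be taken; the `j` directions already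
  -- used are parameters.
  have main : ∀ k j : ℕ, ∀ (hj : (j : ℕ∞) ≤ m), ((j + k : ℕ) : ℕ∞) ≤ m →
      CkFam.{u, v, w} M k (X × (Fin j → dir M))
        (fun q => extendZero fun z : M => Cm.d j hj (c q.1) (z, q.2)) := by
    intro k
    induction k with
    | zero => exact fun j hj _ => hcont j hj
    | succ k ih =>
      intro j hj hjk
      have hj1 : ((j + 1 : ℕ) : ℕ∞) ≤ m :=
        le_trans (by exact_mod_cast (by omega : j + 1 ≤ j + (k + 1))) hjk
      refine ⟨hcont j hj, _, (ih (j + 1) hj1 (by rwa [add_assoc, add_comm 1 k])).comp_param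
        (φ := fun q : (X × (Fin j → dir M)) × dir M => (q.1.1, Fin.snoc q.1.2 q.2)) ?_, ?_⟩
      · fun_prop
      · rintro ⟨x, ys⟩ y p hp
        have hpM := intrinsicInterior_subset hp
        obtain ⟨d', hd', hd⟩ := Cm.isIterDirDeriv_d hj1 (c x)
        have h := hd ⟨p, hpM⟩ hp (Fin.snoc ys y)
        simp only [Fin.snoc_last, Fin.init_snoc] at h
        have h' := hasDirDerivAt_congr h hp y.2
          (g' := fun z => Cm.d j hj (c x) (z, ys))
          (fun z hz => hd'.unique (Cm.isIterDirDeriv_d hj (c x)) z hz ys)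
        dsimp only
        rw [extendZero_apply _ hpM]
        exact h'
  have h0 : ((0 : ℕ) : ℕ∞) ≤ m := by simp
  have hzero : ∀ x : X, (fun z : M => Cm.d 0 h0 (c x) (z, Fin.elim0)) = c x := by
    intro x
    have hd := Cm.isIterDirDeriv_d h0 (c x)
    exact eq_of_eq_intrinsicInterior hM (by fun_prop) (c x).2.1 fun z hz => hd z hz _
  have h1 := (main k 0 h0 (by rwa [zero_add])).comp_param
    (φ := fun x : X => (x, (Fin.elim0 : Fin 0 → dir M))) (by fun_prop)
  simpa only [hzero] using h1

/-- A family which is a continuous family of `C^k`-functions for all `k ≤ m` is given by a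
continuous map to the space of `C^m`-functions. -/
theorem exists_continuous_cm [T2Space Y] (hM : Convex ℝ M) {f : X → E → Y}
    (hf : ∀ k : ℕ, (k : ℕ∞) ≤ m → CkFam.{u, v, w} M k X f) :
    ∃ c : X → Cm m M Y, Continuous c ∧ ∀ x (p : M), c x p = f x p := by
  have hcm : ∀ x, IsCm m (fun z : M => f x z) := by
    intro x
    refine ⟨continuousOn_iff_continuous_domRestrict.1 ((hf 0 (by simp)).continuousOn_apply x),
      fun k hk => ?_⟩
    obtain ⟨D, hD, hDi⟩ := (hf k hk).exists_isIterDirDeriv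
    exact ⟨⟨fun q => D (x, q), by fun_prop⟩, hDi x⟩
  refine ⟨fun x => ⟨fun z : M => f x z, hcm x⟩, ?_, fun _ _ => rfl⟩
  refine continuous_iInf_rng.2 fun k => continuous_iInf_rng.2 fun hk => continuous_induced_rng.2 ?_
  obtain ⟨D, hD, hDi⟩ := (hf k hk).exists_isIterDirDeriv
  -- Currying the jointly continuous derivative gives continuity for the compact-open topology.
  have h1 : Continuous fun x => (ContinuousMap.curry ⟨D, hD⟩ x : C(M × (Fin k → dir M), Y)) :=
    ContinuousMap.continuous _
  convert h1 using 1
  funext x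
  apply ContinuousMap.ext
  intro q
  exact congrFun ((Cm.isIterDirDeriv_d (M := M) hk ⟨fun z => f x z, hcm x⟩).unique_continuous hM (hDi x)
    (ContinuousMap.continuous _) (by fun_prop)) q

theorem Cm.continuous_eval [T2Space Y] (hM : Convex ℝ M) (hMc : IsCompact M) (x : M) :
    Continuous fun f : Cm m M Y => f x := by
  have h := (ckFam_of_continuous_cm.{u, v, max u v} hM hMc (c := fun f : Cm m M Y => f)
    continuous_id (k := 0) (by simp)).continuousOn
  have h1 : Continuous fun f : Cm m M Y => extendZero f x := by
    exact h.comp_continuous (f := fun f : Cm m M Y => (f, (x : E))) (by fun_prop)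
      fun f => ⟨mem_univ _, x.2⟩
  simpa only [extendZero_coe] using h1

end Bridge

/-! ### Extension from the skeleton of an orthant -/

section SkeletonExtension

universe u v w

variable {E : Type u} {Y : Type v} [AddCommGroup Y] {ι : Type*} [Fintype ι]

/-- Extension of functions on the `ℓ`-dimensional skeleton of an orthant with the coordinate
projections `π S`: the values at the origin are extended first, and then the error on the
coordinate subspaces of each dimension is corrected in turn. -/
def skeletonExt (π : Finset ι → E → E) : ℕ → (E → Y) → E → Y
  | 0, φ => fun x => φ (π ∅ x)
  | l + 1, φ => fun x => skeletonExt π l φ x +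
      ∑ S ∈ Finset.powersetCard (l + 1) Finset.univ, (φ (π S x) - skeletonExt π l φ (π S x))

variable {π : Finset ι → E → E}

theorem skeletonExt_add (l : ℕ) (φ ψ : E → Y) (x : E) :
    skeletonExt π l (φ + ψ) x = skeletonExt π l φ x + skeletonExt π l ψ x := by
  induction l generalizing x with
  | zero => rfl
  | succ l ih =>
    simp only [skeletonExt, ih, Pi.add_apply, add_sub_add_comm, Finset.sum_add_distrib]
    abel

theorem skeletonExt_smul [Module ℝ Y] (l : ℕ) (c : ℝ) (φ : E → Y) (x : E) :
    skeletonExt π l (c • φ) x = c • skeletonExt π l φ x := by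
  induction l generalizing x with
  | zero => rfl
  | succ l ih =>
    simp only [skeletonExt, ih, Pi.smul_apply, ← smul_sub, ← Finset.smul_sum, smul_add]

/-- At a point fixed by `π U`, the correction for `S` is the earlier error at a point fixed by `π (U
∩ S)`. By induction it vanishes unless `U ∩ S` has `l + 1` elements, that is `S = U`, and then it is
exactly the missing error. -/
theorem skeletonExt_eq_of_proj_eq [DecidableEq ι] (hπ : ∀ S T x, π S (π T x) = π (S ∩ T) x)
    {l : ℕ} (φ : E → Y) {U : Finset ι} (hU : U.card ≤ l) {x : E} (hx : π U x = x) :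
    skeletonExt π l φ x = φ x := by
  induction l generalizing U x with
  | zero =>
    obtain rfl : U = ∅ := by simpa using hU
    simp [skeletonExt, hx]
  | succ l ih =>
    have key : ∀ S : Finset ι, (U ∩ S).card ≤ l → φ (π S x) - skeletonExt π l φ (π S x) = 0 := by
      intro S hS
      rw [ih hS, sub_self]
      rw [hπ, Finset.inter_assoc, Finset.inter_self, Finset.inter_comm, ← hπ, hx]
    simp only [skeletonExt]
    rcases Nat.lt_or_ge l U.card with h | h
    · have hc : U.card = l + 1 := by omega
      rw [Finset.sum_eq_single U]
      · rw [hx]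
        abel
      · intro S hS hSU
        refine key S ?_
        have hS' := (Finset.mem_powersetCard.1 hS).2
        by_contra hlt
        have h1 : U ∩ S = U := Finset.eq_of_subset_of_card_le Finset.inter_subset_left (by omega)
        have h2 : U ∩ S = S := Finset.eq_of_subset_of_card_le Finset.inter_subset_right (by omega)
        exact hSU (h2.symm.trans h1)
      · intro hn
        exact absurd (Finset.mem_powersetCard.2 ⟨Finset.subset_univ _, hc⟩) hn
    · rw [ih h hx, Finset.sum_eq_zero, add_zero]
      exact fun S _ => key S ((Finset.card_le_card Finset.inter_subset_left).trans h)

variable [AddCommGroup E] [Module ℝ E] [TopologicalSpace E] [IsTopologicalAddGroup E]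
  [ContinuousSMul ℝ E]
variable [Module ℝ Y] [TopologicalSpace Y] [IsTopologicalAddGroup Y] [ContinuousSMul ℝ Y]
variable {M : Set E} {X : Type (max u w)} [TopologicalSpace X]

theorem CkFam.skeletonExt [DecidableEq ι] (hπ : ∀ S T x, π S (π T x) = π (S ∩ T) x) {k l : ℕ}
    {φ : X → E → Y}
    (h : ∀ T : Finset ι, T.card ≤ l → CkFam.{u, v, w} M k X (fun x p => φ x (π T p))) :
    CkFam.{u, v, w} M k X (fun x => skeletonExt π l (φ x)) := by
  -- The corrections evaluate the previous stage at `π S x`, so the induction must also control all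
  -- composites with projections.
  suffices CkFam.{u, v, w} M k X (fun x => PolytopeExt.skeletonExt π l (φ x)) ∧
      ∀ R, CkFam.{u, v, w} M k X (fun x p => PolytopeExt.skeletonExt π l (φ x) (π R p)) from this.1
  induction l with
  | zero =>
    refine ⟨h ∅ (by simp), fun R => ?_⟩
    simpa only [PolytopeExt.skeletonExt, hπ, Finset.empty_inter] using h ∅ (by simp)
  | succ l ih =>
    obtain ⟨h1, h2⟩ := ih fun T hT => h T (hT.trans (Nat.le_succ l))
    have hc : ∀ S ∈ Finset.powersetCard (l + 1) (Finset.univ : Finset ι), S.card = l + 1 :=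
      fun S hS => (Finset.mem_powersetCard.1 hS).2
    refine ⟨h1.add (CkFam.sum _ fun S hS => (h S (hc S hS).le).sub (h2 S)), fun R => ?_⟩
    refine (h2 R).add (CkFam.sum _ fun S hS => ?_)
    simp only [hπ]
    exact (h (S ∩ R) ((Finset.card_le_card Finset.inter_subset_left).trans (hc S hS).le)).sub
      (h2 (S ∩ R))

end SkeletonExtension

/-! ### Finitely generated cones and their extreme rays -/

section Cone

variable {E : Type*} [AddCommGroup E] [Module ℝ E]

open scoped NNReal

theorem combo_sub {α β : ℝ} (h : α + β = 1) (x y v : E) :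
    α • x + β • y - v = α • (x - v) + β • (y - v) := by
  rw [smul_sub, smul_sub, sub_add_sub_comm, ← add_smul, h, one_smul]

theorem mem_span_nnreal_iff {B : Finset E} {x : E} :
    x ∈ Submodule.span ℝ≥0 (B : Set E) ↔
      ∃ f : E → ℝ, (∀ b, 0 ≤ f b) ∧ ∑ b ∈ B, f b • b = x := by
  rw [Submodule.mem_span_finset']
  constructor
  · rintro ⟨f, rfl⟩
    classical
    refine ⟨fun b => if h : b ∈ B then (f ⟨b, h⟩ : ℝ) else 0, fun b => ?_, ?_⟩
    · dsimp only
      split_ifs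
      exacts [NNReal.coe_nonneg _, le_rfl]
    · rw [← Finset.sum_coe_sort B]
      refine Finset.sum_congr rfl fun b _ => ?_
      simp [NNReal.smul_def]
  · rintro ⟨f, hf, rfl⟩
    refine ⟨fun b => ⟨f b, hf b⟩, ?_⟩
    rw [← Finset.sum_coe_sort B]
    rfl

theorem exists_minimal_generators (D : Finset E) :
    ∃ B ⊆ D, Submodule.span ℝ≥0 (B : Set E) = Submodule.span ℝ≥0 (D : Set E) ∧
      ∀ b ∈ B, b ∉ Submodule.span ℝ≥0 ((B : Set E) \ {b}) := by
  classical
  induction D using Finset.strongInduction with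
  | H D ih =>
    by_cases h : ∀ b ∈ D, b ∉ Submodule.span ℝ≥0 ((D : Set E) \ {b})
    · exact ⟨D, subset_rfl, rfl, h⟩
    · push Not at h
      obtain ⟨b, hb, hbs⟩ := h
      obtain ⟨B, hB, hBs, hBm⟩ := ih (D.erase b) (Finset.erase_ssubset hb)
      refine ⟨B, hB.trans (Finset.erase_subset _ _), ?_, hBm⟩
      rw [hBs, Finset.coe_erase]
      refine le_antisymm (Submodule.span_mono sdiff_subset) (Submodule.span_le.2 fun x hx => ?_)
      by_cases hxb : x = b
      · rw [hxb]
        exact hbs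
      · exact Submodule.subset_span ⟨hx, hxb⟩

/-- A minimal system of generators of a pointed cone spans extreme rays. -/
theorem mem_ray_of_add_eq {B : Finset E}
    (hp : ∀ f : E → ℝ, (∀ b ∈ B, 0 ≤ f b) → ∑ b ∈ B, f b • b = 0 → ∀ b ∈ B, f b = 0)
    (hm : ∀ b ∈ B, b ∉ Submodule.span ℝ≥0 ((B : Set E) \ {b})) {b : E} (hb : b ∈ B) {x y : E}
    (hx : x ∈ Submodule.span ℝ≥0 (B : Set E)) (hy : y ∈ Submodule.span ℝ≥0 (B : Set E)) {t : ℝ}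
    (h : x + y = t • b) : ∃ s : ℝ, 0 ≤ s ∧ x = s • b := by
  classical
  obtain ⟨f, hf, rfl⟩ := mem_span_nnreal_iff.1 hx
  obtain ⟨g, hg, rfl⟩ := mem_span_nnreal_iff.1 hy
  have hsum : ∑ c ∈ B.erase b, (f c + g c) • c = (t - f b - g b) • b := by
    rw [← Finset.sum_add_distrib, ← Finset.add_sum_erase _ _ hb] at h
    simp only [add_smul]
    rw [sub_smul, sub_smul, ← h]
    abel
  -- A positive coefficient would make `b` redundant. Otherwise moving it to the left gives a
  -- vanishing nonnegative combination, whose coefficients are zero by pointedness.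
  rcases lt_or_ge 0 (t - f b - g b) with hs | hs
  · refine absurd ?_ (hm b hb)
    rw [← Finset.coe_erase, mem_span_nnreal_iff]
    refine ⟨fun c => (t - f b - g b)⁻¹ * (f c + g c), fun c => ?_, ?_⟩
    · have := hf c
      have := hg c
      positivity
    · simp only [mul_smul, ← Finset.smul_sum, hsum]
      rw [smul_smul, inv_mul_cancel₀ hs.ne', one_smul]
  · have h0 := hp (fun c => if c = b then -(t - f b - g b) else f c + g c) (fun c _ => by
      split_ifs
      · linarith
      · exact add_nonneg (hf c) (hg c)) (by
      rw [← Finset.add_sum_erase _ _ hb, Finset.sum_congr rfl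
        (g := fun c => (f c + g c) • c) fun c hc => by rw [if_neg (Finset.ne_of_mem_erase hc)],
        hsum, if_pos rfl, ← add_smul, neg_add_cancel, zero_smul])
    refine ⟨f b, hf b, Finset.sum_eq_single_of_mem b hb fun c hc hcb => ?_⟩
    have h1 := h0 c hc
    rw [if_neg hcb] at h1
    rw [show f c = 0 by linarith [hf c, hg c], zero_smul]

end Cone

/-! ### Edges at a vertex of a simple polytope -/

section Vertices

variable {E : Type*} [AddCommGroup E] [Module ℝ E]

open scoped NNReal

theorem IsPolytope.convex {M : Set E} (hM : IsPolytope M) : Convex ℝ M := by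
  obtain ⟨S, -, -, rfl⟩ := hM
  exact convex_convexHull ℝ S

theorem isFace_singleton_iff {M : Set E} {v : E} : IsFace M {v} ↔ v ∈ M.extremePoints ℝ := by
  simp [IsFace, convex_singleton]

/-- The edges of a simple polytope at a vertex `v` provide affine coordinates such that the
polytope is contained in the positive orthant. -/
structure VertexChart (n : ℕ) (M : Set E) (v : E) where
  /-- The edge vectors. -/
  edge : Fin n → E
  /-- The coordinates. -/
  coord : Fin n → E →ₗ[ℝ] ℝ
  coord_edge : ∀ i j, coord i (edge j) = if i = j then 1 else 0
  add_edge_mem : ∀ i, v + edge i ∈ M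
  coord_nonneg : ∀ x ∈ M, ∀ i, 0 ≤ coord i (x - v)
  sum_coord : ∀ x ∈ M, ∑ i, coord i (x - v) • edge i = x - v

theorem exists_dual_family {n : ℕ} {b : Fin n → E} (hb : LinearIndependent ℝ b) :
    ∃ c : Fin n → E →ₗ[ℝ] ℝ, ∀ i j, c i (b j) = if i = j then 1 else 0 := by
  obtain ⟨g, hg⟩ := (Module.Basis.span hb).repr.toLinearMap.exists_extend
  refine ⟨fun i => (Finsupp.lapply i).comp g, fun i j => ?_⟩
  have h1 := LinearMap.congr_fun hg (Module.Basis.span hb j)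
  have h2 : ((Module.Basis.span hb j : Submodule.span ℝ (range b)) : E) = b j :=
    congrArg Subtype.val (Module.Basis.span_apply hb j)
  simp only [LinearMap.comp_apply, Submodule.subtype_apply, h2] at h1
  simp only [LinearMap.comp_apply, h1]
  simp [Finsupp.single_apply, eq_comm]

/-- Choose a minimal set `B` of generators of the cone of `M` at `v`. Its elements span distinct
edges of `M`, so simplicity gives `B.card ≤ n`; they also span `dir M`, of dimension `n`. Hence
there are exactly `n` of them and they are independent. -/
theorem exists_linearIndependent_edges [FiniteDimensional ℝ E] {n : ℕ} {M : Set E}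
    (hM : IsSimplePolytope n M) {v : E} (hv : IsFace M {v}) :
    ∃ b : Fin n → E, LinearIndependent ℝ b ∧ (∀ i, v + b i ∈ M) ∧
      ∀ x ∈ M, ∃ a : Fin n → ℝ, (∀ i, 0 ≤ a i) ∧ ∑ i, a i • b i = x - v := by
  classical
  obtain ⟨hMp, hdim, hedges⟩ := hM
  have hconv := hMp.convex
  have hvM : v ∈ M := hv.2.subset rfl
  have hdiff : Convex ℝ (M \ {v}) := hv.2.convex_sdiff hconv
  obtain ⟨S, hS, -, hMS⟩ := hMp
  have hSM : S ⊆ M := hMS ▸ subset_convexHull ℝ S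
  set D : Finset E := (hS.toFinset.erase v).image (· - v) with hD
  have hDM : ∀ d ∈ D, v + d ∈ M \ {v} := by
    intro d hd
    obtain ⟨s, hs, rfl⟩ := Finset.mem_image.1 hd
    rw [Finset.mem_erase, Set.Finite.mem_toFinset] at hs
    rw [add_sub_cancel]
    exact ⟨hSM hs.2, hs.1⟩
  obtain ⟨B, hBD, hBs, hBm⟩ := exists_minimal_generators D
  have hBM : ∀ b ∈ B, v + b ∈ M \ {v} := fun b hb => hDM b (hBD hb)
  have hB0 : ∀ b ∈ B, b ≠ 0 := by
    rintro b hb rfl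
    exact (hBM 0 hb).2 (by simp)
  have hcone : ∀ x ∈ M, x - v ∈ Submodule.span ℝ≥0 (B : Set E) := by
    have h1 : Convex ℝ {x | x - v ∈ Submodule.span ℝ≥0 (B : Set E)} := by
      intro x hx y hy α β hα hβ hαβ
      have h1 : x - v ∈ Submodule.span ℝ≥0 (B : Set E) := hx
      have h2 : y - v ∈ Submodule.span ℝ≥0 (B : Set E) := hy
      have := Submodule.add_mem _ (Submodule.smul_mem _ (⟨α, hα⟩ : ℝ≥0) h1)
        (Submodule.smul_mem _ (⟨β, hβ⟩ : ℝ≥0) h2)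
      change α • (x - v) + β • (y - v) ∈ Submodule.span ℝ≥0 (B : Set E) at this
      rwa [← combo_sub hαβ] at this
    have h2 : M ⊆ {x | x - v ∈ Submodule.span ℝ≥0 (B : Set E)} := by
      rw [hMS]
      refine convexHull_min (fun s hs => ?_) h1
      by_cases hsv : s = v
      · simp [hsv]
      · rw [mem_ofPred_eq, hBs]
        exact Submodule.subset_span (Finset.mem_image.2 ⟨s, by simp [hs, hsv], rfl⟩)
    exact h2
  -- A nontrivial vanishing combination, normalised, would exhibit `v` as a convex combination of
  -- points of `M \ {v}`, which is convex as `v` is extreme.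
  have hpoint : ∀ f : E → ℝ, (∀ b ∈ B, 0 ≤ f b) → ∑ b ∈ B, f b • b = 0 → ∀ b ∈ B, f b = 0 := by
    intro f hf hsum
    by_contra! hne
    obtain ⟨b, hb, hfb⟩ := hne
    have hpos : 0 < ∑ b ∈ B, f b :=
      Finset.sum_pos' hf ⟨b, hb, lt_of_le_of_ne (hf b hb) hfb.symm⟩
    have := hdiff.sum_mem (t := B) (w := fun b => (∑ b ∈ B, f b)⁻¹ * f b) (z := fun b => v + b)
      (fun b hb => mul_nonneg (inv_nonneg.2 hpos.le) (hf b hb))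
      (by rw [← Finset.mul_sum, inv_mul_cancel₀ hpos.ne']) hBM
    simp only [smul_add, Finset.sum_add_distrib, mul_smul, ← Finset.smul_sum, hsum,
      ← Finset.sum_smul, smul_zero, add_zero] at this
    rw [smul_smul, inv_mul_cancel₀ hpos.ne', one_smul] at this
    exact this.2 rfl
  -- The part of `M` on the ray from `v` through `v + b`, shown below to be an edge.
  let F : E → Set E := fun b => {x | x ∈ M ∧ ∃ t : ℝ, 0 ≤ t ∧ x - v = t • b}
  have hvF : ∀ b, v ∈ F b := fun b => ⟨hvM, 0, le_rfl, by simp⟩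
  have hbF : ∀ b ∈ B, v + b ∈ F b := fun b hb => ⟨(hBM b hb).1, 1, zero_le_one, by simp⟩
  have hFface : ∀ b ∈ B, F b ∈ faces M 1 := by
    intro b hb
    refine ⟨⟨?_, ⟨fun x hx => hx.1, ?_⟩⟩, ⟨v, hvF b⟩, ?_⟩
    · rintro x ⟨hx, t, ht, hxt⟩ y ⟨hy, s, hs, hys⟩ α β hα hβ hαβ
      refine ⟨hconv hx hy hα hβ hαβ, α * t + β * s, by positivity, ?_⟩
      rw [add_smul, mul_smul, mul_smul, ← hxt, ← hys, combo_sub hαβ]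
    · rintro x hx y hy z ⟨-, t, ht, hzt⟩ ⟨α, β, hα, hβ, hαβ, hz⟩
      have h1 : α • (x - v) + β • (y - v) = t • b := by
        rw [← hzt, ← hz, combo_sub hαβ]
      obtain ⟨s, hs, hxs⟩ := mem_ray_of_add_eq hpoint hBm hb
        (Submodule.smul_mem _ (⟨α, hα.le⟩ : ℝ≥0) (hcone x hx))
        (Submodule.smul_mem _ (⟨β, hβ.le⟩ : ℝ≥0) (hcone y hy)) h1
      change α • (x - v) = s • b at hxs
      refine ⟨hx, α⁻¹ * s, by positivity, ?_⟩
      rw [mul_smul, ← hxs, smul_smul, inv_mul_cancel₀ hα.ne', one_smul]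
    · have : dir (F b) = Submodule.span ℝ {b} := by
        rw [dir, vectorSpan_eq_span_vsub_set_right ℝ (hvF b)]
        apply le_antisymm
        · rw [Submodule.span_le]
          rintro _ ⟨x, ⟨-, t, -, hxt⟩, rfl⟩
          rw [SetLike.mem_coe, Submodule.mem_span_singleton]
          exact ⟨t, hxt.symm⟩
        · rw [Submodule.span_le, singleton_subset_iff]
          exact Submodule.subset_span ⟨v + b, hbF b hb, by simp⟩
      rw [dim, this, finrank_span_singleton (hB0 b hb)]
  have hFinj : InjOn F (B : Set E) := by
    intro b hb c hc hbc
    by_contra hne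
    have h1 : v + c ∈ F b := hbc ▸ hbF c hc
    obtain ⟨-, t, ht, hct⟩ := h1
    rw [add_sub_cancel_left] at hct
    refine hBm c hc ?_
    have := Submodule.smul_mem (Submodule.span ℝ≥0 ((B : Set E) \ {c})) (⟨t, ht⟩ : ℝ≥0)
      (Submodule.subset_span (show b ∈ (B : Set E) \ {c} from ⟨hb, hne⟩))
    change t • b ∈ _ at this
    rwa [← hct] at this
  have hcard : B.card ≤ n := by
    have h1 : F '' (B : Set E) ⊆ {F : Set E | F ∈ faces M 1 ∧ v ∈ F} := by
      rintro _ ⟨b, hb, rfl⟩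
      exact ⟨hFface b hb, hvF b⟩
    have h2 := Set.encard_le_encard h1
    rw [hFinj.encard_image, hedges v hv, Set.encard_coe_eq_coe_finsetCard] at h2
    exact_mod_cast h2
  have hspan : dir M ≤ Submodule.span ℝ (B : Set E) := by
    rw [dir, vectorSpan_eq_span_vsub_set_right ℝ hvM, Submodule.span_le]
    rintro _ ⟨x, hx, rfl⟩
    obtain ⟨f, -, hf⟩ := mem_span_nnreal_iff.1 (hcone x hx)
    dsimp only
    rw [vsub_eq_sub, ← hf]
    exact Submodule.sum_mem _ fun b hb => Submodule.smul_mem _ _ (Submodule.subset_span hb)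
  have hrank : n ≤ Module.finrank ℝ (Submodule.span ℝ (B : Set E)) := by
    rw [← hdim]
    exact Submodule.finrank_mono hspan
  have hn : B.card = n :=
    le_antisymm hcard (hrank.trans (finrank_span_finset_le_card B))
  let e : Fin n ≃ B := (finCongr hn.symm).trans B.equivFin.symm
  have hrange : range (fun i => (e i : E)) = B := by
    rw [show (fun i => (e i : E)) = Subtype.val ∘ e from rfl, e.surjective.range_comp]
    simp
  refine ⟨fun i => e i, ?_, fun i => (hBM _ (e i).2).1, fun x hx => ?_⟩
  · rw [linearIndependent_iff_card_le_finrank_span, Set.finrank, hrange]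
    simpa using hrank
  · obtain ⟨f, hf, hfx⟩ := mem_span_nnreal_iff.1 (hcone x hx)
    refine ⟨fun i => f (e i), fun i => hf _, ?_⟩
    rw [← hfx, ← Finset.sum_coe_sort B, ← e.sum_comp]

theorem nonempty_vertexChart [FiniteDimensional ℝ E] {n : ℕ} {M : Set E}
    (hM : IsSimplePolytope n M) {v : E} (hv : IsFace M {v}) : Nonempty (VertexChart n M v) := by
  obtain ⟨b, hb, hbM, hx⟩ := exists_linearIndependent_edges hM hv
  obtain ⟨c, hc⟩ := exists_dual_family hb
  have key : ∀ x ∈ M, (∀ i, 0 ≤ c i (x - v)) ∧ ∑ i, c i (x - v) • b i = x - v := by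
    intro x hxM
    obtain ⟨a, ha, hax⟩ := hx x hxM
    have : ∀ i, c i (x - v) = a i := by
      intro i
      rw [← hax]
      simp [hc]
    simp only [this]
    exact ⟨ha, hax⟩
  exact ⟨⟨b, c, hc, hbM, fun x h => (key x h).1, fun x h => (key x h).2⟩⟩

end Vertices

/-! ### Faces, stars and vertices of polytopes -/

section Faces

variable {E : Type*} [AddCommGroup E] [Module ℝ E]

/-- The points `x` of `M` such that the segment from `v` to `x` can be prolonged within `M`. -/
def star (M : Set E) (v : E) : Set E := {x | ∃ r : ℝ, 1 < r ∧ v + r • (x - v) ∈ M}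

theorem star_subset {M : Set E} (hM : Convex ℝ M) {v : E} (hv : v ∈ M) : star M v ⊆ M := by
  rintro x ⟨r, hr, hx⟩
  have h0 : 0 < r := by linarith
  have := hM hv hx (sub_nonneg.2 (inv_le_one_of_one_le₀ hr.le)) (inv_pos.2 h0).le (by ring)
  convert this using 1
  rw [smul_add, smul_smul, inv_mul_cancel₀ h0.ne']
  module

/-- The point `x` is interior to the segment from `v` to the prolonged point, so extremality of `F`
applies. -/
theorem mem_face_of_mem_star {M F : Set E} (hF : IsFace M F) {v x : E} (hv : v ∈ M)
    (hxF : x ∈ F) (hx : x ∈ star M v) : v ∈ F := by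
  obtain ⟨r, hr, hxr⟩ := hx
  have h0 : 0 < r := by linarith
  refine hF.2.left_mem_of_mem_openSegment hv hxr hxF
    ⟨1 - r⁻¹, r⁻¹, sub_pos.2 (inv_lt_one_of_one_lt₀ hr), inv_pos.2 h0, by ring, ?_⟩
  rw [smul_add, smul_smul, inv_mul_cancel₀ h0.ne']
  module

theorem sum_mem_star {M : Set E} (hM : Convex ℝ M) {ι : Type*} {t : Finset ι} {w : ι → ℝ}
    {z : ι → E} (hw : ∀ i ∈ t, 0 ≤ w i) (hw1 : ∑ i ∈ t, w i = 1) (hz : ∀ i ∈ t, z i ∈ M) {i : ι}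
    (hi : i ∈ t) (hwi : 0 < w i) : ∑ i ∈ t, w i • z i ∈ star M (z i) := by
  classical
  -- Prolonging by the factor `1 + w i` changes the weight at `i` to `(1 + w i) * w i - w i = w i ^
  -- 2 ≥ 0`.
  refine ⟨1 + w i, by linarith, ?_⟩
  have hsum := hM.sum_mem (t := t) (w := fun j => (1 + w i) * w j - if j = i then w i else 0)
    (z := z) (fun j hj => ?_) ?_ hz
  · convert hsum using 1
    simp only [sub_smul, Finset.sum_sub_distrib, ite_smul, zero_smul, mul_smul,
      ← Finset.smul_sum, Finset.sum_ite_eq', hi, if_true]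
    module
  · have h2 := hw j hj
    have h3 : w i ≤ 1 := hw1 ▸ Finset.single_le_sum hw hi
    split_ifs with h
    · rw [h]
      nlinarith
    · have : 0 ≤ (1 + w i) * w j := by positivity
      linarith
  · rw [Finset.sum_sub_distrib, ← Finset.mul_sum, hw1, Finset.sum_ite_eq', if_pos hi]
    ring

theorem mem_face_of_sum_mem {M F : Set E} (hM : Convex ℝ M) (hF : IsFace M F) {ι : Type*}
    {t : Finset ι} {w : ι → ℝ} {z : ι → E} (hw : ∀ i ∈ t, 0 ≤ w i) (hw1 : ∑ i ∈ t, w i = 1)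
    (hz : ∀ i ∈ t, z i ∈ M) (hx : ∑ i ∈ t, w i • z i ∈ F) {i : ι} (hi : i ∈ t)
    (hwi : 0 < w i) : z i ∈ F :=
  mem_face_of_mem_star hF (hz i hi) hx (sum_mem_star hM hw hw1 hz hi hwi)

/-- If a convex combination of points of `S` lies in `F`, all points with positive weight do. -/
theorem face_eq_convexHull {S F : Set E} (hF : IsFace (convexHull ℝ S) F) :
    F = convexHull ℝ (S ∩ F) := by
  refine Subset.antisymm (fun x hx => ?_) (convexHull_min inter_subset_right hF.1)
  obtain ⟨ι, _, w, z, hw, hw1, hz, rfl⟩ := (mem_convexHull_iff_exists_fintype (R := ℝ)).1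
    (hF.2.subset hx)
  have key : ∀ i, 0 < w i → z i ∈ F := fun i hi =>
    mem_face_of_sum_mem (convex_convexHull ℝ S) hF (fun i _ => hw i) hw1
      (fun i _ => subset_convexHull ℝ S (hz i)) hx (Finset.mem_univ i) hi
  have hsub : ∀ f : ι → ℝ, (∀ i, w i = 0 → f i = 0) →
      ∑ i with 0 < w i, f i = ∑ i, f i := by
    intro f hf
    refine Finset.sum_subset (Finset.subset_univ _) fun i _ hi => hf i ?_
    simp only [Finset.mem_filter, Finset.mem_univ, true_and, not_lt] at hi
    exact le_antisymm hi (hw i)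
  have h1 : ∑ i with 0 < w i, w i • z i = ∑ i, w i • z i := by
    refine Finset.sum_subset (Finset.subset_univ _) fun i _ hi => ?_
    simp only [Finset.mem_filter, Finset.mem_univ, true_and, not_lt] at hi
    rw [le_antisymm hi (hw i), zero_smul]
  rw [← h1]
  refine (convex_convexHull ℝ (S ∩ F)).sum_mem (fun i _ => hw i) ?_ fun i hi => ?_
  · rw [hsub w fun i hi => hi, hw1]
  · exact subset_convexHull ℝ _ ⟨hz i, key i (Finset.mem_filter.1 hi).2⟩

theorem isPolytope_of_mem_faces {M F : Set E} (hM : IsPolytope M) {d : ℕ} (hF : F ∈ faces M d) :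
    IsPolytope F := by
  obtain ⟨S, hS, -, rfl⟩ := hM
  have h := face_eq_convexHull hF.1
  refine ⟨S ∩ F, hS.inter_of_left F, ?_, h⟩
  by_contra hne
  rw [not_nonempty_iff_eq_empty.1 hne, convexHull_empty] at h
  exact hF.2.1.ne_empty h

theorem finite_setOf_isFace_singleton {M : Set E} (hM : IsPolytope M) :
    {v : E | IsFace M {v}}.Finite := by
  obtain ⟨S, hS, -, rfl⟩ := hM
  refine hS.subset fun v hv => ?_
  exact extremePoints_convexHull_subset (isFace_singleton_iff.1 hv)

variable [TopologicalSpace E] [IsTopologicalAddGroup E] [ContinuousSMul ℝ E]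

theorem IsPolytope.isCompact {M : Set E} (hM : IsPolytope M) : IsCompact M := by
  obtain ⟨S, hS, -, rfl⟩ := hM
  exact hS.isCompact_convexHull (𝕜 := ℝ)

variable [T2Space E] [FiniteDimensional ℝ E]

theorem locallyConvexSpace_of_finiteDimensional : LocallyConvexSpace ℝ E := by
  let e : E ≃L[ℝ] (Fin (Module.finrank ℝ E) → ℝ) := ContinuousLinearEquiv.ofFinrankEq (by simp)
  rw [e.toHomeomorph.isInducing.eq_induced]
  exact LocallyConvexSpace.induced e.toLinearMap

/-- By Krein–Milman `x` is a convex combination of vertices; any vertex of positive weight works. -/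
theorem exists_vertex_mem_star {M : Set E} (hM : IsPolytope M) {x : E} (hx : x ∈ M) :
    ∃ v, IsFace M {v} ∧ x ∈ star M v := by
  have := locallyConvexSpace_of_finiteDimensional (E := E)
  have hfin : (M.extremePoints ℝ).Finite :=
    (finite_setOf_isFace_singleton hM).subset fun v hv => isFace_singleton_iff.2 hv
  have hconv := hM.convex
  have h1 := closure_convexHull_extremePoints hM.isCompact hconv
  rw [(hfin.isClosed_convexHull (𝕜 := ℝ)).closure_eq] at h1
  rw [← h1, ← hfin.coe_toFinset, Finset.mem_convexHull'] at hx
  obtain ⟨w, hw, hw1, rfl⟩ := hx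
  obtain ⟨v, hv, hvw⟩ : ∃ v ∈ hfin.toFinset, 0 < w v := by
    by_contra! hn
    have := Finset.sum_nonpos hn
    linarith
  exact ⟨v, isFace_singleton_iff.2 (hfin.mem_toFinset.1 hv), sum_mem_star (z := id) hconv hw hw1
    (fun u hu => extremePoints_subset (hfin.mem_toFinset.1 hu)) hv hvw⟩

end Faces

/-! ### Coordinate projections and faces at a vertex -/

namespace VertexChart

section Algebra

variable {E : Type*} [AddCommGroup E] [Module ℝ E] {n : ℕ} {M : Set E} {v : E}
  (κ : VertexChart n M v)

/-- The cone with vertex `v` spanned by the edges at `v`. -/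
def cone : Set E := {x | (∀ i, 0 ≤ κ.coord i (x - v)) ∧ ∑ i, κ.coord i (x - v) • κ.edge i = x - v}

theorem subset_cone : M ⊆ κ.cone := fun x hx => ⟨κ.coord_nonneg x hx, κ.sum_coord x hx⟩

/-- The projection to a coordinate subspace. -/
def proj (T : Finset (Fin n)) : E →ᵃ[ℝ] E where
  toFun x := v + ∑ i ∈ T, κ.coord i (x - v) • κ.edge i
  linear := ∑ i ∈ T, (κ.coord i).smulRight (κ.edge i)
  map_vadd' x y := by
    simp [LinearMap.sum_apply, add_sub_assoc, add_smul, Finset.sum_add_distrib]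
    abel

theorem proj_apply (T : Finset (Fin n)) (x : E) :
    κ.proj T x = v + ∑ i ∈ T, κ.coord i (x - v) • κ.edge i := rfl

theorem coord_proj (T : Finset (Fin n)) (x : E) (j : Fin n) :
    κ.coord j (κ.proj T x - v) = if j ∈ T then κ.coord j (x - v) else 0 := by
  simp [proj_apply, κ.coord_edge]

theorem proj_proj (S T : Finset (Fin n)) (x : E) :
    κ.proj S (κ.proj T x) = κ.proj (S ∩ T) x := by
  rw [κ.proj_apply S]
  simp only [coord_proj, ite_smul, zero_smul]
  rw [Finset.sum_ite_mem, proj_apply]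

theorem proj_mem_cone (T : Finset (Fin n)) {x : E} (hx : x ∈ κ.cone) : κ.proj T x ∈ κ.cone := by
  refine ⟨fun i => ?_, ?_⟩
  · rw [coord_proj]
    split_ifs
    exacts [hx.1 i, le_rfl]
  · simp only [coord_proj, ite_smul, zero_smul]
    rw [Finset.sum_ite_mem, Finset.univ_inter, proj_apply, add_sub_cancel_left]

theorem linearIndependent_edge : LinearIndependent ℝ κ.edge := by
  rw [Fintype.linearIndependent_iff]
  intro g hg i
  have := congrArg (κ.coord i) hg
  simpa [κ.coord_edge] using this

/-- The face of `M` spanned by a set of edges at `v`. -/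
def face (T : Finset (Fin n)) : Set E := {x | x ∈ M ∧ ∀ i ∉ T, κ.coord i (x - v) = 0}

theorem proj_eq_of_mem_face {T : Finset (Fin n)} {x : E} (hx : x ∈ κ.face T) :
    κ.proj T x = x := by
  have h := κ.sum_coord x hx.1
  rw [proj_apply, Finset.sum_subset (Finset.subset_univ T), h, add_sub_cancel]
  intro i _ hi
  rw [hx.2 i hi, zero_smul]

theorem proj_mem_face {S T : Finset (Fin n)} (hST : S ⊆ T) {x : E} (hx : κ.proj S x ∈ M) :
    κ.proj S x ∈ κ.face T :=
  ⟨hx, fun i hi => by rw [coord_proj, if_neg fun h => hi (hST h)]⟩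

theorem self_mem_face (hv : v ∈ M) (T : Finset (Fin n)) : v ∈ κ.face T :=
  ⟨hv, fun i _ => by simp⟩

theorem add_edge_mem_face {T : Finset (Fin n)} {i : Fin n} (hi : i ∈ T) :
    v + κ.edge i ∈ κ.face T :=
  ⟨κ.add_edge_mem i, fun j hj => by
    rw [add_sub_cancel_left, κ.coord_edge, if_neg]
    rintro rfl
    exact hj hi⟩

theorem edge_mem_dir {F : Set E} (hv : v ∈ F) {i : Fin n} (hi : v + κ.edge i ∈ F) :
    κ.edge i ∈ dir F := by
  have := vsub_mem_vectorSpan ℝ hi hv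
  simpa using this

theorem linear_proj_mem_dir_face (hv : v ∈ M) {S T : Finset (Fin n)} (hST : S ⊆ T) (y : E) :
    (κ.proj S).linear y ∈ dir (κ.face T) := by
  change (∑ i ∈ S, (κ.coord i).smulRight (κ.edge i)) y ∈ _
  rw [LinearMap.sum_apply]
  exact Submodule.sum_mem _ fun i hi => Submodule.smul_mem _ _
    (κ.edge_mem_dir (κ.self_mem_face hv T) (κ.add_edge_mem_face (hST hi)))

theorem isFace_face (hM : Convex ℝ M) (T : Finset (Fin n)) : IsFace M (κ.face T) := by
  refine ⟨?_, ⟨fun x hx => hx.1, ?_⟩⟩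
  · intro x hx y hy α β hα hβ hαβ
    refine ⟨hM hx.1 hy.1 hα hβ hαβ, fun i hi => ?_⟩
    rw [combo_sub hαβ, map_add, map_smul, map_smul, hx.2 i hi, hy.2 i hi]
    simp
  · rintro x hx y hy z hz ⟨α, β, hα, hβ, hαβ, rfl⟩
    refine ⟨hx, fun i hi => ?_⟩
    have h := hz.2 i hi
    rw [combo_sub hαβ, map_add, map_smul, map_smul, smul_eq_mul, smul_eq_mul] at h
    have h1 := κ.coord_nonneg x hx i
    have h2 := κ.coord_nonneg y hy i
    have h3 : 0 ≤ β * κ.coord i (y - v) := by positivity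
    have h4 : 0 ≤ α * κ.coord i (x - v) := by positivity
    have h5 : α * κ.coord i (x - v) = 0 := by linarith
    exact (mul_eq_zero.1 h5).resolve_left hα.ne'

theorem dim_face (hv : v ∈ M) (T : Finset (Fin n)) : dim (κ.face T) = T.card := by
  have h : dir (κ.face T) = Submodule.span ℝ (range fun i : T => κ.edge i) := by
    apply le_antisymm
    · rw [dir, vectorSpan_eq_span_vsub_set_right ℝ (κ.self_mem_face hv T), Submodule.span_le]
      rintro _ ⟨x, hx, rfl⟩
      dsimp only
      rw [vsub_eq_sub, ← κ.proj_eq_of_mem_face hx, proj_apply, add_sub_cancel_left]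
      exact Submodule.sum_mem _ fun i hi => Submodule.smul_mem _ _
        (Submodule.subset_span ⟨⟨i, hi⟩, rfl⟩)
    · rw [Submodule.span_le]
      rintro _ ⟨i, rfl⟩
      exact κ.edge_mem_dir (κ.self_mem_face hv T) (κ.add_edge_mem_face i.2)
  have h1 := finrank_span_eq_card
    (κ.linearIndependent_edge.comp (Subtype.val : T → Fin n) Subtype.val_injective)
  rw [Fintype.card_coe] at h1
  rw [dim, h, ← h1]
  rfl

theorem face_mem_faces (hM : Convex ℝ M) (hv : v ∈ M) (T : Finset (Fin n)) :
    κ.face T ∈ faces M T.card :=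
  ⟨κ.isFace_face hM T, ⟨v, κ.self_mem_face hv T⟩, κ.dim_face hv T⟩

/-- A point of `F` on the segment from `v` to `x`, close enough to `v`, is a convex combination of
`v` and the points `v + edge i` with positive weight at the given `i`. -/
theorem add_edge_mem_of_coord_pos (hM : Convex ℝ M) {F : Set E} (hF : IsFace M F) (hv : v ∈ F)
    {x : E} (hx : x ∈ F) {i : Fin n} (hi : 0 < κ.coord i (x - v)) : v + κ.edge i ∈ F := by
  have hxM := hF.2.subset hx
  have hvM := hF.2.subset hv
  set K : ℝ := ∑ i, κ.coord i (x - v) with hK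
  have hK0 : 0 ≤ K := Finset.sum_nonneg fun i _ => κ.coord_nonneg x hxM i
  have hδ : 0 < (1 + K)⁻¹ := by positivity
  have hδK : (1 + K)⁻¹ * K = 1 - (1 + K)⁻¹ := by
    field_simp
    ring
  have hδ1 : (1 + K)⁻¹ ≤ 1 := inv_le_one_of_one_le₀ (by linarith)
  have hmem : v + (1 + K)⁻¹ • (x - v) ∈ F := by
    have := hF.1 hv hx (sub_nonneg.2 hδ1) hδ.le (by ring)
    convert this using 1
    module
  refine mem_face_of_sum_mem (ι := Option (Fin n)) (t := Finset.univ)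
    (w := fun o => o.elim (1 + K)⁻¹ fun i => (1 + K)⁻¹ * κ.coord i (x - v))
    (z := fun o => o.elim v fun i => v + κ.edge i) hM hF ?_ ?_ ?_ ?_ (Finset.mem_univ (some i)) ?_
  · rintro (_ | j) -
    exacts [hδ.le, mul_nonneg hδ.le (κ.coord_nonneg x hxM j)]
  · rw [Fintype.sum_option]
    simp only [Option.elim, ← Finset.mul_sum, ← hK, hδK]
    ring
  · rintro (_ | j) -
    exacts [hvM, κ.add_edge_mem j]
  · rw [Fintype.sum_option]
    simp only [Option.elim, smul_add, Finset.sum_add_distrib, mul_smul, ← Finset.smul_sum,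
      κ.sum_coord x hxM, ← Finset.sum_smul, ← hK]
    rw [← add_assoc, smul_smul, hδK, ← add_smul, add_sub_cancel, one_smul]
    exact hmem
  · exact mul_pos hδ hi

/-- The edge vectors on which `x` has nonzero coordinate are independent and lie in `dir F`, so
there are at most `ℓ` of them. -/
theorem exists_proj_eq [FiniteDimensional ℝ E] (hM : Convex ℝ M) {ℓ : ℕ} {F : Set E}
    (hF : F ∈ faces M ℓ) (hv : v ∈ F) {x : E} (hx : x ∈ F) :
    ∃ U : Finset (Fin n), U.card ≤ ℓ ∧ κ.proj U x = x := by
  classical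
  have hxM := hF.1.2.subset hx
  refine ⟨Finset.univ.filter fun i => κ.coord i (x - v) ≠ 0, ?_,
    κ.proj_eq_of_mem_face ⟨hxM, fun i hi => by simpa using hi⟩⟩
  set U := Finset.univ.filter fun i => κ.coord i (x - v) ≠ 0 with hU
  have hspan : Submodule.span ℝ (range fun i : U => κ.edge i) ≤ dir F := by
    rw [Submodule.span_le]
    rintro _ ⟨⟨i, hi⟩, rfl⟩
    have hi' := (Finset.mem_filter.1 hi).2
    exact κ.edge_mem_dir hv (κ.add_edge_mem_of_coord_pos hM hF.1 hv hx
      (lt_of_le_of_ne (κ.coord_nonneg x hxM i) hi'.symm))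
  have h := Submodule.finrank_mono hspan
  have h1 := finrank_span_eq_card
    (κ.linearIndependent_edge.comp (Subtype.val : U → Fin n) Subtype.val_injective)
  rw [Fintype.card_coe] at h1
  exact (h1.symm.trans_le h).trans_eq hF.2.2

end Algebra

/-! ### Stars are relatively open in the cone -/

section Topology

variable {E : Type*} [AddCommGroup E] [Module ℝ E] [TopologicalSpace E] [IsTopologicalAddGroup E]
  [ContinuousSMul ℝ E] [T2Space E] [FiniteDimensional ℝ E] {n : ℕ} {M : Set E} {v : E}
  (κ : VertexChart n M v)

/-- Write `y - v` as `s * r⁻¹` times `r • (x - v)` plus the coordinates of `y - s x` (taken from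
`v`) times the edges. For `s < 1` near `1` and `y` in the cone near `x`, the weights are nonnegative
with sum `A < 1`, so prolonging by `A⁻¹` gives a convex combination of points of `M`. -/
theorem eventually_mem_star (hM : Convex ℝ M) (hv : v ∈ M) {x : E} (hx : x ∈ star M v) :
    ∀ᶠ y in 𝓝 x, y ∈ κ.cone → y ∈ star M v := by
  have hxc := κ.subset_cone (star_subset hM hv hx)
  obtain ⟨r, hr, hxr⟩ := hx
  have hr0 : 0 < r := by linarith
  set K : ℝ := ∑ i, κ.coord i (x - v) with hK
  obtain ⟨s, hs, hs0, hs1⟩ : ∃ s : ℝ, s * r⁻¹ + (1 - s) * K < 1 ∧ 0 < s ∧ s < 1 := by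
    have hc : Continuous fun s : ℝ => s * r⁻¹ + (1 - s) * K := by fun_prop
    have hev := (hc.tendsto 1).eventually (gt_mem_nhds
      (show 1 * r⁻¹ + (1 - 1) * K < 1 by simpa using inv_lt_one_of_one_lt₀ hr))
    obtain ⟨s, hs, hs'⟩ := ((hev.filter_mono (nhdsWithin_le_nhds (s := Iio 1))).and
      (Ioo_mem_nhdsLT (zero_lt_one' ℝ))).exists
    exact ⟨s, hs, hs'.1, hs'.2⟩
  have hcc : ∀ i, Continuous (κ.coord i) := fun i => (κ.coord i).continuous_of_finiteDimensional
  have hev1 : ∀ᶠ y in 𝓝 x,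
      s * r⁻¹ + ∑ i, (κ.coord i (y - v) - s * κ.coord i (x - v)) < 1 := by
    have hc : Continuous fun y =>
        s * r⁻¹ + ∑ i, (κ.coord i (y - v) - s * κ.coord i (x - v)) := by fun_prop
    refine (hc.tendsto x).eventually (gt_mem_nhds ?_)
    rw [Finset.sum_sub_distrib, ← Finset.mul_sum, ← hK]
    linarith
  have hev2 : ∀ᶠ y in 𝓝 x, ∀ i, y ∈ κ.cone → 0 ≤ κ.coord i (y - v) - s * κ.coord i (x - v) := by
    rw [eventually_all]
    intro i
    -- Vanishing coordinates of `x` need `y` in the cone; positive ones leave slack since `s < 1`.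
    rcases (hxc.1 i).eq_or_lt with h | h
    · filter_upwards with y hy
      rw [← h, mul_zero, sub_zero]
      exact hy.1 i
    · have hc : Continuous fun y => κ.coord i (y - v) - s * κ.coord i (x - v) := by fun_prop
      filter_upwards [(hc.tendsto x).eventually (lt_mem_nhds
        (show 0 < κ.coord i (x - v) - s * κ.coord i (x - v) by nlinarith))] with y hy _
      exact hy.le
  filter_upwards [hev1, hev2] with y hy1 hy2 hyc
  set A : ℝ := s * r⁻¹ + ∑ i, (κ.coord i (y - v) - s * κ.coord i (x - v)) with hA
  have hsr : 0 < s * r⁻¹ := by positivity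
  have hA0 : 0 < A :=
    add_pos_of_pos_of_nonneg hsr (Finset.sum_nonneg fun i _ => hy2 i hyc)
  refine ⟨A⁻¹, one_lt_inv_iff₀.2 ⟨hA0, hy1⟩, ?_⟩
  have hmem := hM.sum_mem (t := (Finset.univ : Finset (Option (Fin n))))
    (w := fun o => o.elim (A⁻¹ * (s * r⁻¹))
      fun i => A⁻¹ * (κ.coord i (y - v) - s * κ.coord i (x - v)))
    (z := fun o => o.elim (v + r • (x - v)) fun i => v + κ.edge i) ?_ ?_ ?_
  · convert hmem using 1
    rw [Fintype.sum_option]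
    simp only [Option.elim, smul_add, Finset.sum_add_distrib, mul_smul, ← Finset.smul_sum,
      ← Finset.sum_smul, sub_smul, Finset.sum_sub_distrib, hyc.2, hxc.2]
    rw [smul_smul r⁻¹, inv_mul_cancel₀ hr0.ne', one_smul]
    have hv1 : v = A⁻¹ • A • v := by rw [smul_smul, inv_mul_cancel₀ hA0.ne', one_smul]
    rw [Finset.sum_sub_distrib, ← Finset.mul_sum] at hA
    nth_rw 1 [hv1]
    rw [hA]
    module
  · rintro (_ | j) -
    · exact mul_nonneg (inv_nonneg.2 hA0.le) hsr.le
    · exact mul_nonneg (inv_nonneg.2 hA0.le) (hy2 j hyc)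
  · rw [Fintype.sum_option]
    simp only [Option.elim, ← Finset.mul_sum]
    rw [← mul_add, ← hA, inv_mul_cancel₀ hA0.ne']
  · rintro (_ | j) -
    exacts [hxr, κ.add_edge_mem j]

/-- An open set whose intersection with the cone at the vertex `v` is contained in the polytope. -/
def nhd : Set E := interior (κ.coneᶜ ∪ star M v)

theorem isOpen_nhd : IsOpen κ.nhd := isOpen_interior

theorem mem_star_of_mem_nhd {x : E} (hx : x ∈ κ.nhd) (hxc : x ∈ κ.cone) : x ∈ star M v :=
  (interior_subset hx).resolve_left fun h => h hxc

theorem star_subset_nhd (hM : Convex ℝ M) (hv : v ∈ M) : star M v ⊆ κ.nhd := by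
  intro x hx
  rw [nhd, mem_interior_iff_mem_nhds]
  filter_upwards [κ.eventually_mem_star hM hv hx] with y hy
  by_cases h : y ∈ κ.cone
  exacts [Or.inr (hy h), Or.inl h]

end Topology

end VertexChart

/-! ### Smooth cut-off functions -/

section Cutoffs

universe u w

variable {E : Type u} [AddCommGroup E] [Module ℝ E] [TopologicalSpace E]

/-- Smooth functions on a finite-dimensional vector space, expressed in linear coordinates. -/
def IsSmooth (u : E → ℝ) : Prop :=
  ∃ (d : ℕ) (e : E →L[ℝ] (Fin d → ℝ)) (U : (Fin d → ℝ) → ℝ),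
    ContDiff ℝ (⊤ : ℕ∞) U ∧ u = U ∘ e

variable [IsTopologicalAddGroup E] [ContinuousSMul ℝ E]

theorem IsSmooth.ckFam {u : E → ℝ} (hu : IsSmooth u) (M : Set E) (k : ℕ)
    (X : Type (max u w)) [TopologicalSpace X] : CkFam.{u, 0, w} M k X (fun _ => u) := by
  obtain ⟨d, e, U, hU, rfl⟩ := hu
  exact ckFam_of_contDiff e (W := ℝ) (U := fun q => U q.2) (hU.comp contDiff_snd)
    (φ := fun _ => 0) continuous_const

variable [T2Space E] [FiniteDimensional ℝ E]

theorem IsSmooth.comp_affine {u : E → ℝ} (hu : IsSmooth u) (π : E →ᵃ[ℝ] E) :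
    IsSmooth fun x => u (π x) := by
  obtain ⟨d, e, U, hU, rfl⟩ := hu
  refine ⟨d, e.comp (LinearMap.toContinuousLinearMap π.linear), fun z => U (z + e (π 0)),
    hU.comp (contDiff_id.add contDiff_const), ?_⟩
  funext x
  simp only [Function.comp_apply, ContinuousLinearMap.comp_apply,
    LinearMap.coe_toContinuousLinearMap', ← map_add]
  rw [show π x = π.linear x + π 0 from congrFun π.decomp x]

open scoped Manifold in
/-- A smooth partition of unity subordinate to a finite open cover of a compact set, together
with cut-off functions which are `1` on the supports. -/
theorem exists_cutoffs {ι : Type*} [Fintype ι] {M : Set E} (hM : IsCompact M) {O : ι → Set E}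
    (hO : ∀ i, IsOpen (O i)) (hMO : M ⊆ ⋃ i, O i) :
    ∃ h χ : ι → E → ℝ, (∀ i, IsSmooth (h i)) ∧ (∀ i, IsSmooth (χ i)) ∧
      (∀ x ∈ M, ∑ i, h i x = 1) ∧
      (∀ i, ∃ O₂, IsOpen O₂ ∧ O i ∪ O₂ = univ ∧ ∀ x ∈ O₂, h i x = 0) ∧
      (∀ i x, χ i x * h i x = h i x) ∧ ∀ i, ∀ x ∉ O i, χ i x = 0 := by
  let e : E ≃L[ℝ] (Fin (Module.finrank ℝ E) → ℝ) := ContinuousLinearEquiv.ofFinrankEq (by simp)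
  obtain ⟨f, hf⟩ := SmoothPartitionOfUnity.exists_isSubordinate
    𝓘(ℝ, Fin (Module.finrank ℝ E) → ℝ) (hM.image e.continuous).isClosed
    (fun i => e.symm ⁻¹' O i) (fun i => (hO i).preimage e.symm.continuous) (by
      rintro _ ⟨x, hx, rfl⟩
      simpa using hMO hx)
  have hχ : ∀ i, ∃ χ : (Fin (Module.finrank ℝ E) → ℝ) → ℝ, ContDiff ℝ (⊤ : ℕ∞) χ ∧
      (∀ x ∉ e.symm ⁻¹' O i, χ x = 0) ∧ ∀ x ∈ tsupport (f i), χ x = 1 := by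
    intro i
    obtain ⟨χ, h0, h1, -⟩ := exists_contMDiffMap_zero_one_of_isClosed (n := (⊤ : ℕ∞))
      𝓘(ℝ, Fin (Module.finrank ℝ E) → ℝ)
      ((hO i).preimage e.symm.continuous).isClosed_compl (isClosed_tsupport (f i))
      (disjoint_compl_left_iff_subset.2 (hf i))
    exact ⟨χ, χ.contMDiff.contDiff, h0, h1⟩
  choose χ hχs hχ0 hχ1 using hχ
  refine ⟨fun i x => f i (e x), fun i x => χ i (e x),
    fun i => ⟨_, (e : E →L[ℝ] _), f i, (f i).contMDiff.contDiff, rfl⟩,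
    fun i => ⟨_, (e : E →L[ℝ] _), χ i, hχs i, rfl⟩, fun x hx => ?_, fun i => ?_, fun i x => ?_,
    fun i x hx => hχ0 i (e x) (by simpa using hx)⟩
  · rw [← finsum_eq_sum_of_fintype]
    exact f.sum_eq_one (mem_image_of_mem e hx)
  · refine ⟨e ⁻¹' (tsupport (f i))ᶜ,
      (isClosed_tsupport (f i)).isOpen_compl.preimage e.continuous, ?_,
      fun x hx => image_eq_zero_of_notMem_tsupport hx⟩
    refine eq_univ_of_forall fun x => ?_
    by_cases hx : e x ∈ tsupport (f i)
    · exact Or.inl (by simpa using hf i hx)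
    · exact Or.inr hx
  · dsimp only
    by_cases hx : e x ∈ tsupport (f i)
    · rw [hχ1 i _ hx, one_mul]
    · rw [image_eq_zero_of_notMem_tsupport hx, mul_zero]

end Cutoffs

/-! ### The global extension operator and restriction -/

section Extension

universe u v

variable {E : Type u} [AddCommGroup E] [Module ℝ E] [TopologicalSpace E]
  [IsTopologicalAddGroup E] [ContinuousSMul ℝ E] [T2Space E] [FiniteDimensional ℝ E]
variable {Y : Type v} [AddCommGroup Y] [Module ℝ Y] [TopologicalSpace Y]
  [IsTopologicalAddGroup Y] [ContinuousSMul ℝ Y]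
variable {m : ℕ∞} {n ℓ : ℕ} {M : Set E}

theorem Cm.ext {f g : Cm m M Y} (h : ∀ x, f x = g x) : f = g := Subtype.ext (funext h)

open Classical in
/-- The function on `E` given by a compatible family on the union of the `ℓ`-dimensional faces,
and by zero elsewhere. -/
def skeletonValue (g : compatible m M ℓ Y) (z : E) : Y :=
  if h : ∃ F : faces M ℓ, z ∈ (F : Set E) then g.1 h.choose ⟨z, h.choose_spec⟩ else 0

theorem skeletonValue_eq (g : compatible m M ℓ Y) (F : faces M ℓ) {z : E} (hz : z ∈ (F : Set E)) :
    skeletonValue g z = g.1 F ⟨z, hz⟩ := by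
  have h : ∃ F : faces M ℓ, z ∈ (F : Set E) := ⟨F, hz⟩
  rw [skeletonValue, dif_pos h]
  exact g.2 _ _ z _ _

theorem skeletonValue_add (g g' : compatible m M ℓ Y) (z : E) :
    skeletonValue (g + g') z = skeletonValue g z + skeletonValue g' z := by
  by_cases h : ∃ F : faces M ℓ, z ∈ (F : Set E)
  · obtain ⟨F, hF⟩ := h
    simp only [skeletonValue_eq _ F hF]
    rfl
  · simp only [skeletonValue, dif_neg h, add_zero]

theorem skeletonValue_smul (c : ℝ) (g : compatible m M ℓ Y) (z : E) :
    skeletonValue (c • g) z = c • skeletonValue g z := by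
  by_cases h : ∃ F : faces M ℓ, z ∈ (F : Set E)
  · obtain ⟨F, hF⟩ := h
    simp only [skeletonValue_eq _ F hF]
    rfl
  · simp only [skeletonValue, dif_neg h, smul_zero]

variable {V : Set E} [Fintype V] (κ : ∀ v : V, VertexChart n M v) (h χ : V → E → ℝ)

/-- The extension operator, obtained by gluing the local extension operators at the vertices. -/
def extension (g : compatible m M ℓ Y) (x : E) : Y :=
  ∑ v, χ v x • skeletonExt (fun T => (κ v).proj T) ℓ (fun z => h v z • skeletonValue g z) x

theorem extension_add (g g' : compatible m M ℓ Y) (x : E) :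
    extension κ h χ (g + g') x = extension κ h χ g x + extension κ h χ g' x := by
  simp only [extension, ← Finset.sum_add_distrib, ← smul_add, ← skeletonExt_add,
    skeletonValue_add]
  simp only [smul_add]
  rfl

theorem extension_smul (c : ℝ) (g : compatible m M ℓ Y) (x : E) :
    extension κ h χ (c • g) x = c • extension κ h χ g x := by
  have hs : ∀ v : V, (fun z => h v z • skeletonValue (c • g) z) =
      c • fun z => h v z • skeletonValue g z := fun v => funext fun z => by
    rw [skeletonValue_smul, smul_comm]
    rfl
  simp only [extension, Finset.smul_sum, hs, skeletonExt_smul]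
  exact Finset.sum_congr rfl fun v _ => smul_comm _ _ _

/-- If `v ∈ F`, the local extension at `v` reproduces `h v • g` at `x`. If `v ∉ F`, then `x` is not
in the star of `v`, so `χ v x = 0`, and with it `h v x = 0`. The sum of the `h v` is `1`. -/
theorem extension_eq (hM : Convex ℝ M) (hV : ∀ v ∈ V, v ∈ M)
    (hh : ∀ x ∈ M, ∑ v, h v x = 1) (hχh : ∀ v x, χ v x * h v x = h v x)
    (hχ : ∀ v, ∀ x ∉ (κ v).nhd, χ v x = 0) (g : compatible m M ℓ Y) (F : faces M ℓ) {x : E}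
    (hx : x ∈ (F : Set E)) : extension κ h χ g x = g.1 F ⟨x, hx⟩ := by
  have hxM : x ∈ M := F.2.1.2.subset hx
  have key : ∀ v : V, χ v x • skeletonExt (fun T => (κ v).proj T) ℓ
      (fun z => h v z • skeletonValue g z) x = h v x • g.1 F ⟨x, hx⟩ := by
    intro v
    by_cases hvF : (v : E) ∈ (F : Set E)
    · obtain ⟨U, hU, hUx⟩ := (κ v).exists_proj_eq hM F.2 hvF hx
      rw [skeletonExt_eq_of_proj_eq (κ v).proj_proj _ hU hUx, skeletonValue_eq g F hx, smul_smul,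
        hχh]
    · have h0 : χ v x = 0 := hχ v x fun hxv => hvF <| mem_face_of_mem_star F.2.1 (hV v v.2) hx <|
        (κ v).mem_star_of_mem_nhd hxv ((κ v).subset_cone hxM)
      rw [← hχh, h0, zero_mul, zero_smul, zero_smul]
  rw [extension, Finset.sum_congr rfl fun v _ => key v, ← Finset.sum_smul, hh x hxM, one_smul]

variable [T2Space Y] [LocallyConvexSpace ℝ Y]

theorem ckFam_extension (hM : IsPolytope M) (hℓ : ℓ ≤ n) (hV : ∀ v ∈ V, v ∈ M)
    (hhs : ∀ v, IsSmooth (h v)) (hχs : ∀ v, IsSmooth (χ v))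
    (hh : ∀ v, ∃ O₂, IsOpen O₂ ∧ (κ v).nhd ∪ O₂ = univ ∧ ∀ x ∈ O₂, h v x = 0)
    {k : ℕ} (hk : (k : ℕ∞) ≤ m) :
    CkFam.{u, v, v} M k (compatible m M ℓ Y) (fun g => extension κ h χ g) := by
  have hMc := hM.convex
  refine CkFam.sum _ fun v _ => ((hχs v).ckFam M k _).smul ?_
  refine CkFam.skeletonExt (φ := fun (g : compatible m M ℓ Y) z => h v z • skeletonValue g z)
    (κ v).proj_proj fun T hT => ?_
  have hvM := hV v v.2
  -- The family lives on `ℓ`-dimensional faces only, so the smaller coordinate face is embedded into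
  -- one of them.
  obtain ⟨T', hTT', hT'⟩ := Finset.exists_superset_card_eq hT (by simpa using hℓ)
  have hF : (κ v).face T' ∈ faces M ℓ := hT' ▸ (κ v).face_mem_faces hMc hvM T'
  obtain ⟨O₂, hO₂, hOU, hO0⟩ := hh v
  have hπc : Continuous ((κ v).proj T) := by
    rw [((κ v).proj T).decomp]
    exact ((κ v).proj T).linear.continuous_of_finiteDimensional.add continuous_const
  have hPQ : ∀ p ∈ M, (κ v).proj T p ∈ (κ v).nhd → (κ v).proj T p ∈ (κ v).face T' :=
    fun p hp hpn => (κ v).proj_mem_face hTT' <| star_subset hMc hvM <|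
      (κ v).mem_star_of_mem_nhd hpn ((κ v).proj_mem_cone T ((κ v).subset_cone hp))
  have hcov : ∀ p, (κ v).proj T p ∈ (κ v).nhd ∨ (κ v).proj T p ∈ O₂ := fun p =>
    (mem_union _ _ _).1 (hOU ▸ mem_univ _)
  have hFp := isPolytope_of_mem_faces hM hF
  have hfam : CkFam.{u, v, v} ((κ v).face T') k (compatible m M ℓ Y)
      (fun g => extendZero (g.1 ⟨_, hF⟩)) :=
    ckFam_of_continuous_cm hFp.convex hFp.isCompact
      (c := fun g : compatible m M ℓ Y => g.1 ⟨_, hF⟩)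
      ((continuous_apply _).comp continuous_subtype_val) hk
  -- The projection of `p ∈ M` stays in the cone. Inside `nhd` it therefore lies in `M`, hence in
  -- the face; elsewhere `h v` vanishes at it, and the values chosen off the face are irrelevant.
  refine (CkFam.pullback hMc hFp.convex ((κ v).proj T)
    (fun y _ => (κ v).linear_proj_mem_dir_face hvM hTT' y)
    ((κ v).isOpen_nhd.preimage hπc) (hO₂.preimage hπc) (fun p _ => hcov p) hPQ
    (((hhs v).comp_affine ((κ v).proj T)).ckFam M k _) (fun _ p _ hp => hO0 _ hp) hfam).congr ?_
    fun p hp y hy => eventually_add_smul_mem_intrinsicInterior hp hy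
  intro g p hp
  rcases hcov p with hp' | hp'
  · rw [extendZero_apply _ (hPQ p hp hp'), skeletonValue_eq g ⟨_, hF⟩ (hPQ p hp hp')]
  · simp only [hO0 _ hp', zero_smul]

/-- Restriction to a face is a continuous map between spaces of `C^m`-functions. -/
theorem exists_continuous_restrict (hM : IsPolytope M) {F : Set E} (hF : IsPolytope F)
    (hFM : F ⊆ M) :
    ∃ c : Cm m M Y → Cm m F Y, Continuous c ∧ ∀ f, ∀ x (hx : x ∈ F),
      c f ⟨x, hx⟩ = f ⟨x, hFM hx⟩ := by
  -- Restriction is the pull-back along the identity with cut-off `1`; this covers faces contained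
  -- in the relative boundary of `M`.
  obtain ⟨c, hc, hcf⟩ := exists_continuous_cm.{u, v, v} (m := m) (Y := Y) hF.convex
    (X := Cm m M Y) (f := fun f p => (1 : ℝ) • extendZero f (AffineMap.id ℝ E p)) fun k hk =>
      CkFam.pullback hF.convex hM.convex (AffineMap.id ℝ E) (fun y hy => vectorSpan_mono ℝ hFM hy)
        isOpen_univ isOpen_empty (fun p _ => Or.inl (mem_univ p)) (fun p hp _ => hFM hp)
        (u := fun _ _ => (1 : ℝ)) (ckFam_of_continuous continuous_const)
        (fun _ _ _ h => absurd h (notMem_empty _))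
        (ckFam_of_continuous_cm hM.convex hM.isCompact continuous_id hk)
  refine ⟨c, hc, fun f x hx => ?_⟩
  rw [hcf, one_smul]
  exact extendZero_apply f (hFM hx)

theorem isClosed_compatible (hM : IsPolytope M) :
    IsClosed (compatible m M ℓ Y : Set ((F : faces M ℓ) → Cm m (F : Set E) Y)) := by
  have h : (compatible m M ℓ Y : Set ((F : faces M ℓ) → Cm m (F : Set E) Y)) =
      ⋂ (F : faces M ℓ) (G : faces M ℓ) (x : E) (hF : x ∈ (F : Set E)) (hG : x ∈ (G : Set E)),
        {f | f F ⟨x, hF⟩ = f G ⟨x, hG⟩} := by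
    ext f
    simp only [mem_iInter]
    rfl
  have hev : ∀ (F : faces M ℓ) (x : (F : Set E)),
      Continuous fun f : (F : faces M ℓ) → Cm m (F : Set E) Y => f F x := fun F x =>
    (Cm.continuous_eval (isPolytope_of_mem_faces hM F.2).convex
      (isPolytope_of_mem_faces hM F.2).isCompact x).comp (continuous_apply F)
  rw [h]
  exact isClosed_iInter fun F => isClosed_iInter fun G => isClosed_iInter fun x =>
    isClosed_iInter fun hF => isClosed_iInter fun hG => isClosed_eq (hev F _) (hev G _)

end Extension

end PolytopeExt

end

/-! ### The theorem: restriction and its continuous linear right inverse -/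

theorem theoremB
    {E : Type*} [AddCommGroup E] [Module ℝ E] [FiniteDimensional ℝ E]
    [TopologicalSpace E] [IsTopologicalAddGroup E] [ContinuousSMul ℝ E] [T2Space E]
    {Y : Type*} [AddCommGroup Y] [Module ℝ Y]
    [TopologicalSpace Y] [IsTopologicalAddGroup Y] [ContinuousSMul ℝ Y] [T2Space Y]
    [LocallyConvexSpace ℝ Y]
    (m : ℕ∞) (n ℓ : ℕ) (hℓ : 1 ≤ ℓ) (hℓn : ℓ + 1 ≤ n)
    (M : Set E) (hM : PolytopeExt.IsSimplePolytope n M) :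
    IsClosed (PolytopeExt.compatible m M ℓ Y :
      Set ((F : PolytopeExt.faces M ℓ) → PolytopeExt.Cm m (F : Set E) Y)) ∧
    ∃ r : PolytopeExt.Cm m M Y →L[ℝ] PolytopeExt.compatible m M ℓ Y,
      (∀ (f : PolytopeExt.Cm m M Y) (F : PolytopeExt.faces M ℓ) (x : E)
        (hF : x ∈ (F : Set E)) (hx : x ∈ M),
          (r f : (F : PolytopeExt.faces M ℓ) → PolytopeExt.Cm m (F : Set E) Y) F ⟨x, hF⟩
            = f ⟨x, hx⟩) ∧
      Function.Surjective r ∧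
      ∃ σ : PolytopeExt.compatible m M ℓ Y →L[ℝ] PolytopeExt.Cm m M Y,
        ∀ g : PolytopeExt.compatible m M ℓ Y, r (σ g) = g := by
  have hMp := hM.1
  refine ⟨PolytopeExt.isClosed_compatible hMp, ?_⟩
  choose c hc hcf using fun F : PolytopeExt.faces M ℓ =>
    PolytopeExt.exists_continuous_restrict (m := m) (Y := Y) hMp
      (PolytopeExt.isPolytope_of_mem_faces hMp F.2) F.2.1.2.subset
  let r : PolytopeExt.Cm m M Y →L[ℝ] PolytopeExt.compatible m M ℓ Y :=
    { toFun := fun f => ⟨fun F => c F f, fun F G x hF hG => by rw [hcf, hcf]⟩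
      map_add' := fun f g => Subtype.ext <| funext fun F => PolytopeExt.Cm.ext fun x => by
        change c F (f + g) x = c F f x + c F g x
        rw [hcf, hcf, hcf]
        rfl
      map_smul' := fun a f => Subtype.ext <| funext fun F => PolytopeExt.Cm.ext fun x => by
        change c F (a • f) x = a • c F f x
        rw [hcf, hcf]
        rfl
      cont := (continuous_pi fun F => hc F).subtype_mk _ }
  have hr : ∀ (f : PolytopeExt.Cm m M Y) (F : PolytopeExt.faces M ℓ) (x : E)
      (hF : x ∈ (F : Set E)) (hx : x ∈ M),
        (r f : (F : PolytopeExt.faces M ℓ) → PolytopeExt.Cm m (F : Set E) Y) F ⟨x, hF⟩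
          = f ⟨x, hx⟩ := fun f F x hF hx => hcf F f x hF
  obtain ⟨σ, hσ⟩ : ∃ σ : PolytopeExt.compatible m M ℓ Y →L[ℝ] PolytopeExt.Cm m M Y,
      ∀ g, r (σ g) = g := by
    let V : Set E := {v | PolytopeExt.IsFace M {v}}
    have hV : ∀ v ∈ V, v ∈ M := fun v hv => hv.2.subset rfl
    have : Fintype V := (PolytopeExt.finite_setOf_isFace_singleton hMp).fintype
    let κ : ∀ v : V, PolytopeExt.VertexChart n M v := fun v =>
      Classical.choice (PolytopeExt.nonempty_vertexChart hM v.2)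
    obtain ⟨h, χ, hhs, hχs, hsum, hh, hχh, hχ⟩ := PolytopeExt.exists_cutoffs hMp.isCompact
      (O := fun v : V => (κ v).nhd) (fun v => (κ v).isOpen_nhd) (fun x hx => by
        obtain ⟨v, hv, hxv⟩ := PolytopeExt.exists_vertex_mem_star hMp hx
        exact mem_iUnion.2 ⟨⟨v, hv⟩, (κ ⟨v, hv⟩).star_subset_nhd hMp.convex (hV v hv) hxv⟩)
    obtain ⟨s, hs, hsf⟩ := PolytopeExt.exists_continuous_cm (m := m) hMp.convex fun k hk =>
      PolytopeExt.ckFam_extension (Y := Y) (ℓ := ℓ) κ h χ hMp (by omega) hV hhs hχs hh hk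
    refine ⟨{ toFun := s
              map_add' := fun g g' => PolytopeExt.Cm.ext fun x => ?_
              map_smul' := fun a g => PolytopeExt.Cm.ext fun x => ?_
              cont := hs }, fun g => ?_⟩
    · change s (g + g') x = s g x + s g' x
      simp only [hsf, PolytopeExt.extension_add]
    · change s (a • g) x = a • s g x
      simp only [hsf, PolytopeExt.extension_smul]
    · refine Subtype.ext <| funext fun F => PolytopeExt.Cm.ext fun x => ?_
      have hxM : (x : E) ∈ M := F.2.1.2.subset x.2
      refine (hr _ F x x.2 hxM).trans ((hsf g ⟨x, hxM⟩).trans ?_)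
      exact PolytopeExt.extension_eq κ h χ hMp.convex hV hsum hχh hχ g F x.2
  exact ⟨r, hr, fun g => ⟨σ g, hσ g⟩, σ, hσ⟩
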